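/- For a finite abelian group $G$ of order $N$ and a set $A \subset G$, let $\Gamma_A$ be the Cayley sum graph of $A$: the graph with vertex set $G$ in which distinct $x,y$ are joined if and only if $x+y \in A$. Write $\chi$ for the chromatic number, and for $X \subset G$ write $X \hat{+} X = \{x+x' : x,x' \in X,\ x \neq x'\}$. Let $\varepsilon > 0$. Let $A$ be chosen uniformly at random from all $2^N$ subsets of $G$. Then, as $N \to \infty$ with $(N,6)=1$, uniformly over all abelian groups $G$ of order $N$, $$\mathbb{P}\Big(\chi(\Gamma_A) \le (1+\varepsilon)\frac{N}{2\log_2 N}\Big) \to 1.$$ That is, for every $\delta > 0$ there is $N_0 = N_0(\varepsilon,\delta)$ such that this probability is at least $1-\delta$ for every abelian group $G$ of order $N \ge N_0$ with $(N,6)=1$. Equivalently, in arithmetic form: with $r = \big\lfloor (1+\varepsilon)\frac{N}{2\log_2 N} \big\rfloor$, in the same sense, with probability tending to $1$ there is a partition $G = X_1 \cup \dots \cup X_r$ into $r$ nonempty sets such that $X_i \hat{+} X_i \subset A$ for all $i$. -/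

import Mathlib

/-- The Cayley sum graph of `A ⊆ G`: distinct `x, y` are joined iff `x + y ∈ A`. -/
def cayleySumGraph {G : Type*} [AddCommGroup G] (A : Set G) : SimpleGraph G where
  Adj x y := x ≠ y ∧ x + y ∈ A
  symm := ⟨fun x y h => ⟨h.1.symm, by rw [add_comm]; exact h.2⟩⟩
  loopless := ⟨fun _ h => h.1 rfl⟩

/-- The restricted sumset `{x + x' : x, x' ∈ X, x ≠ x'}`. -/
def restrictedSumset {G : Type*} [AddCommGroup G] (X : Set G) : Set G :=
  {z | ∃ x ∈ X, ∃ x' ∈ X, x ≠ x' ∧ x + x' = z}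

/-- The probability of an event `E` for a subset of the finite set `G` chosen uniformly among
all subsets of `G`. -/
noncomputable def randomSubsetProb {G : Type*} [Fintype G] (E : Set (Set G)) : ℝ :=
  ((PMF.uniformOfFintype (Set G)).toOuterMeasure E).toReal

/-- `X₀, …, X_{r-1}` is a partition of `G` into `r` nonempty, pairwise disjoint sets. -/
structure IsPartitionInto {G : Type*} (r : ℕ) (X : Fin r → Set G) : Prop where
  nonempty : ∀ i, (X i).Nonempty
  disjoint : ∀ i j, i ≠ j → Disjoint (X i) (X j)
  cover : ⋃ i, X i = Set.univ

/-!
Colour greedily. If every `s`-element subset of a set `P` contains an independent set of size `k`,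
then `P` can be coloured with `#P / k + s` colours, so `k` close to `2 log₂ N` and
`s = o(N / log N)` would suffice for `P = G`. The difficulty is the union bound over all
`s`-element sets `S`: Janson's inequality, applied to the `k`-tuples in `S` whose pair sums are
distinct, only shows that `S` fails with probability `exp (-c s ^ 4 / (k ^ 4 E[S]))`, with `E[S]`
the additive energy, and there are too many sets `S ⊆ G` for this.

So first split `G` into `m` parts, with `m` a power of `log N`. For a random split the total
additive energy of the parts is `O(N ^ 3 / m ^ 3)`, because the four entries of most additive
quadruples must land in the same part. Parts of small energy are small and contain few sets `S`,
each of small energy, so the union bound works inside them; parts of large energy contain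
`o(N / log N)` elements in total, and each of these elements receives its own colour.

The variance term in Janson's inequality counts pairs of tuples `x`, `y` by their overlap graph on
the indices of `y`, whose edges are the pair sums of `y` that are also pair sums of `x`. A graph
of rank `r` has at most `(r + 1).choose 2` edges, while a spanning forest recovers `y` from `x` up
to `(k ^ 4) ^ r * #S ^ (k - r)` choices. Rank one contributes the additive energy and larger ranks
contribute less.
-/

open Finset
open scoped BigOperators Combinatorics.Additive

section RandomSubset

variable {G : Type*} [Fintype G]

theorem randomSubsetProb_eq_expect (E : Set (Set G)) :
    randomSubsetProb E = 𝔼 A : Finset G, E.indicator 1 (A : Set G) := by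
  classical
  rw [Fintype.expect_equiv Fintype.finsetEquivSet (fun A => E.indicator 1 (A : Set G))
    (E.indicator (1 : Set G → ℝ)) fun _ => rfl, Fintype.expect_eq_sum_div_card, randomSubsetProb,
    PMF.toOuterMeasure_uniformOfFintype_apply, ENNReal.toReal_div,
    ENNReal.toReal_natCast, ENNReal.toReal_natCast, sum_indicator_eq_sum_filter,
    Fintype.card_subtype]
  simp

theorem randomSubsetProb_mono {E F : Set (Set G)} (h : E ⊆ F) :
    randomSubsetProb E ≤ randomSubsetProb F := by
  simp only [randomSubsetProb_eq_expect]
  exact expect_le_expect fun A _ => Set.indicator_le_indicator_of_subset h (by simp) _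

theorem randomSubsetProb_compl (E : Set (Set G)) :
    randomSubsetProb Eᶜ = 1 - randomSubsetProb E := by
  simp only [randomSubsetProb_eq_expect, Set.indicator_compl, Pi.sub_apply, Pi.one_apply,
    expect_sub_distrib, Fintype.expect_const]

theorem randomSubsetProb_biUnion_le {ι : Type*} (I : Finset ι) (E : ι → Set (Set G)) :
    randomSubsetProb (⋃ i ∈ I, E i) ≤ ∑ i ∈ I, randomSubsetProb (E i) := by
  simp only [randomSubsetProb_eq_expect]
  rw [← expect_sum_comm]
  refine expect_le_expect fun A _ => Set.indicator_apply_le' (fun hA => ?_) fun _ =>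
    sum_nonneg fun i _ => Set.indicator_nonneg (by simp) _
  obtain ⟨i, hi, hAi⟩ := Set.mem_iUnion₂.1 hA
  refine le_of_eq_of_le ?_
    (single_le_sum (fun j _ => Set.indicator_nonneg (by simp) _) hi)
  rw [Set.indicator_of_mem hAi]

theorem randomSubsetProb_preimage_compl (E : Set (Set G)) :
    randomSubsetProb (compl ⁻¹' E) = randomSubsetProb E := by
  classical
  simp only [randomSubsetProb_eq_expect]
  refine Fintype.expect_equiv (Equiv.ofBijective compl compl_bijective) _ _ fun A => ?_
  simp [Set.indicator]

end RandomSubset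

theorem expect_mul_le_of_monotone_of_antitone {α : Type*} [DistribLattice α] [OrderBot α]
    [Fintype α] {f g : α → ℝ} (hf : Monotone f) (hg : Antitone g) :
    𝔼 a, f a * g a ≤ (𝔼 a, f a) * 𝔼 a, g a := by
  have h := fkg (μ := fun _ : α => (1 : ℝ)) (f := fun a => f a - f ⊥) (g := fun a => g ⊥ - g a)
    (fun _ => zero_le_one) (fun _ => sub_nonneg.2 (hf bot_le)) (fun _ => sub_nonneg.2 (hg bot_le))
    (fun _ _ hab => sub_le_sub_right (hf hab) _) (fun _ _ hab => sub_le_sub_left (hg hab) _)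
    fun _ _ => le_rfl
  have hcard : (0 : ℝ) < Fintype.card α := Nat.cast_pos.2 Fintype.card_pos
  simp only [one_mul, mul_sub, sub_mul, sum_sub_distrib, sum_const, card_univ, nsmul_eq_mul,
    mul_one, ← sum_mul, ← mul_sum] at h
  simp only [Fintype.expect_eq_sum_div_card]
  rw [div_mul_div_comm, div_le_div_iff₀ hcard (by positivity)]
  nlinarith

section Supersets

variable {G : Type*} [Fintype G] [DecidableEq G]

theorem card_filter_union_eq {D B : Finset G} (h : D ⊆ B) : #{A | A ∪ D = B} = 2 ^ #D := by
  have : ({A | A ∪ D = B} : Finset (Finset G)) = Icc (B \ D) B := by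
    ext A
    simp only [mem_filter, mem_univ, true_and, mem_Icc]
    grind
  rw [this, card_Icc_finset sdiff_subset, card_sdiff_of_subset h,
    Nat.sub_sub_self (card_le_card h)]

theorem expect_superset (D : Finset G) {g : Finset G → ℝ} (hg : ∀ A, g (A ∪ D) = g A) :
    𝔼 A, (if D ⊆ A then g A else 0) = (2 ^ #D)⁻¹ * 𝔼 A, g A := by
  have h : ∑ A, g A = 2 ^ #D * ∑ B, if D ⊆ B then g B else 0 := by
    rw [← sum_fiberwise univ (· ∪ D) g, mul_sum]
    refine sum_congr rfl fun B _ => ?_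
    rw [sum_congr rfl fun A hA => (hg A).symm.trans (congrArg g (mem_filter.1 hA).2), sum_const]
    split_ifs with hB
    · rw [card_filter_union_eq hB, nsmul_eq_mul, Nat.cast_pow, Nat.cast_ofNat]
    · rw [filter_false_of_mem fun A _ (hA : A ∪ D = B) => hB (hA ▸ subset_union_right),
        card_empty, zero_smul, mul_zero]
  rw [Fintype.expect_eq_sum_div_card, Fintype.expect_eq_sum_div_card, h, mul_div_assoc,
    inv_mul_cancel_left₀ (by positivity)]

theorem expect_superset_le (D : Finset G) {g : Finset G → ℝ} (hg : Antitone g) :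
    𝔼 A, (if D ⊆ A then g A else 0) ≤ (2 ^ #D)⁻¹ * 𝔼 A, g A := by
  have hmono : Monotone fun A : Finset G => if D ⊆ A then (1 : ℝ) else 0 := fun A B hAB => by
    by_cases h : D ⊆ A
    · simp [h, h.trans hAB]
    · simp only [h, if_false]; positivity
  have h := expect_mul_le_of_monotone_of_antitone hmono hg
  rw [expect_superset D fun _ => rfl, Fintype.expect_const, mul_one] at h
  simpa only [ite_mul, one_mul, zero_mul] using h

end Supersets

section Janson

variable {G ι : Type*} [DecidableEq G] {D : ι → Finset G} {E : Finset G} {F : Finset ι}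

/-- The number of indices `i ∈ F` whose set `D i` is contained in `A`: the variable to which
Janson's inequality applies. -/
def containedCount (F : Finset ι) (D : ι → Finset G) (A : Finset G) : ℕ := #{i ∈ F | D i ⊆ A}

theorem containedCount_mono (F : Finset ι) (D : ι → Finset G) : Monotone (containedCount F D) :=
  fun _ _ hAB => card_le_card <| monotone_filter_right F fun _ _ h => h.trans hAB

theorem containedCount_union_of_disjoint (h : ∀ i ∈ F, Disjoint (D i) E) (A : Finset G) :
    containedCount F D (A ∪ E) = containedCount F D A :=
  congrArg card <| filter_congr fun i hi =>
    ⟨(h i hi).left_le_of_le_sup_right, fun hA => hA.trans subset_union_left⟩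

theorem containedCount_eq_add (F : Finset ι) (D : ι → Finset G) (E A : Finset G) :
    containedCount F D A = containedCount {j ∈ F | Disjoint (D j) E} D A +
      containedCount {j ∈ F | ¬ Disjoint (D j) E} D A := by
  simp only [containedCount, filter_comm _ (fun _ => _ ⊆ A)]
  exact (card_filter_add_card_filter_not _).symm

theorem antitone_exp_neg_mul_containedCount (F : Finset ι) (D : ι → Finset G) {t : ℝ}
    (ht : 0 ≤ t) : Antitone fun A => Real.exp (-t * containedCount F D A) := fun _ _ hAB =>
  Real.exp_le_exp.2 <| mul_le_mul_of_nonpos_left (Nat.cast_le.2 (containedCount_mono F D hAB))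
    (neg_nonpos.2 ht)

variable [Fintype G]

theorem expect_superset_containedCount_mul_le (F : Finset ι) (D : ι → Finset G) (E : Finset G)
    {g : Finset G → ℝ} (hg : Antitone g) :
    𝔼 A, (if E ⊆ A then containedCount F D A * g A else 0) ≤
      (∑ j ∈ F, (2 ^ #(D j ∪ E))⁻¹) * 𝔼 A, g A := by
  have hcount (A : Finset G) : (if E ⊆ A then containedCount F D A * g A else 0) =
      ∑ j ∈ F, if D j ∪ E ⊆ A then g A else 0 := by
    by_cases h : E ⊆ A <;> simp [containedCount, union_subset_iff, h, ← sum_filter]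
  simp only [hcount]
  rw [expect_sum_comm, sum_mul]
  exact sum_le_sum fun j _ => expect_superset_le _ hg

/- The count splits into `Z`, over the sets disjoint from `E`, and `Y`, over those meeting it. `Z`
is independent of the event `E ⊆ A`, and `exp (-t * Y)` is bounded below by `1 - t * Y`. -/
theorem expect_exp_containedCount_mul_le_superset (F : Finset ι) (D : ι → Finset G)
    (E : Finset G) {t : ℝ} (ht : 0 ≤ t) :
    ((2 ^ #E)⁻¹ - t * ∑ j ∈ F with ¬ Disjoint (D j) E, (2 ^ #(D j ∪ E))⁻¹) *
        𝔼 A, Real.exp (-t * containedCount F D A) ≤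
      𝔼 A, (if E ⊆ A then Real.exp (-t * containedCount F D A) else 0) := by
  set c : ℝ := (2 ^ #E)⁻¹ - t * ∑ j ∈ F with ¬ Disjoint (D j) E, (2 ^ #(D j ∪ E))⁻¹ with hc
  have hright (A : Finset G) :
      0 ≤ if E ⊆ A then Real.exp (-t * containedCount F D A) else 0 := by positivity
  rcases le_or_gt c 0 with hc0 | hc0
  · exact (mul_nonpos_of_nonpos_of_nonneg hc0 (expect_nonneg fun _ _ => (Real.exp_pos _).le)).trans
      (expect_nonneg fun A _ => hright A)
  set Y := containedCount {j ∈ F | ¬ Disjoint (D j) E} D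
  set Z := containedCount {j ∈ F | Disjoint (D j) E} D
  have hYZ (A : Finset G) : (containedCount F D A : ℝ) = Z A + Y A :=
    mod_cast containedCount_eq_add F D E A
  have hZ : Antitone fun A => Real.exp (-t * Z A) := antitone_exp_neg_mul_containedCount _ _ ht
  have hindep : 𝔼 A, (if E ⊆ A then Real.exp (-t * Z A) else 0) =
      (2 ^ #E)⁻¹ * 𝔼 A, Real.exp (-t * Z A) := expect_superset E fun A =>
    congrArg (fun n : ℕ => Real.exp (-t * n)) <|
      containedCount_union_of_disjoint (fun j hj => (mem_filter.1 hj).2) A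
  have hpointwise (A : Finset G) : (if E ⊆ A then Real.exp (-t * Z A) else 0) -
      t * (if E ⊆ A then Y A * Real.exp (-t * Z A) else 0) ≤
      if E ⊆ A then Real.exp (-t * containedCount F D A) else 0 := by
    split_ifs
    · rw [hYZ, mul_add, Real.exp_add]
      nlinarith [Real.add_one_le_exp (-t * Y A), Real.exp_pos (-t * Z A)]
    · simp
  calc c * 𝔼 A, Real.exp (-t * containedCount F D A)
      ≤ c * 𝔼 A, Real.exp (-t * Z A) := by
        refine mul_le_mul_of_nonneg_left (expect_le_expect fun A _ => Real.exp_le_exp.2 ?_) hc0.le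
        rw [hYZ]
        nlinarith [mul_nonneg ht (Nat.cast_nonneg (α := ℝ) (Y A))]
    _ ≤ 𝔼 A, (if E ⊆ A then Real.exp (-t * Z A) else 0) -
          t * 𝔼 A, (if E ⊆ A then Y A * Real.exp (-t * Z A) else 0) := by
        rw [hindep, hc, sub_mul, mul_assoc]
        exact sub_le_sub_left (mul_le_mul_of_nonneg_left
          (expect_superset_containedCount_mul_le _ D E hZ) ht) _
    _ ≤ _ := by
        rw [mul_expect, ← expect_sub_distrib]
        exact expect_le_expect fun A _ => hpointwise A

end Janson

theorem le_mul_exp_of_hasDerivAt_le {f f' c c' : ℝ → ℝ} (hf : ∀ t, HasDerivAt f (f' t) t)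
    (hc : ∀ t, HasDerivAt c (c' t) t) (h : ∀ t, 0 ≤ t → f' t ≤ c' t * f t) {t : ℝ} (ht : 0 ≤ t) :
    f t ≤ f 0 * Real.exp (c t - c 0) := by
  have hderiv (u : ℝ) : HasDerivAt (fun u => f u * Real.exp (-c u))
      ((f' u - c' u * f u) * Real.exp (-c u)) u :=
    ((hf u).mul (hc u).fun_neg.exp).congr_deriv (by ring)
  have hanti : AntitoneOn (fun u => f u * Real.exp (-c u)) (Set.Ici 0) := by
    refine antitoneOn_of_deriv_nonpos (convex_Ici 0)
      (fun u _ => (hderiv u).continuousAt.continuousWithinAt)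
      (fun u _ => (hderiv u).differentiableAt.differentiableWithinAt) fun u hu => ?_
    rw [(hderiv u).deriv]
    exact mul_nonpos_of_nonpos_of_nonneg
      (sub_nonpos.2 (h u (interior_subset hu))) (Real.exp_pos _).le
  calc f t = f t * Real.exp (-c t) * Real.exp (c t) := by rw [mul_assoc, ← Real.exp_add]; simp
    _ ≤ f 0 * Real.exp (-c 0) * Real.exp (c t) := by
        exact mul_le_mul_of_nonneg_right (hanti Set.self_mem_Ici ht ht) (Real.exp_pos _).le
    _ = f 0 * Real.exp (c t - c 0) := by rw [mul_assoc, ← Real.exp_add, neg_add_eq_sub]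

section Janson

variable {G ι : Type*} [Fintype G] [DecidableEq G] {F : Finset ι} {D : ι → Finset G} {Δ : ℝ}

theorem expect_containedCount_mul_exp_ge
    (hΔ : ∑ i ∈ F, ∑ j ∈ F with ¬ Disjoint (D j) (D i), (2 ^ #(D j ∪ D i) : ℝ)⁻¹ ≤ Δ)
    {t : ℝ} (ht : 0 ≤ t) :
    (∑ i ∈ F, (2 ^ #(D i) : ℝ)⁻¹ - t * Δ) * 𝔼 A, Real.exp (-t * containedCount F D A) ≤
      𝔼 A, containedCount F D A * Real.exp (-t * containedCount F D A) := by
  have hcount (A : Finset G) : containedCount F D A * Real.exp (-t * containedCount F D A) =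
      ∑ i ∈ F, if D i ⊆ A then Real.exp (-t * containedCount F D A) else 0 := by
    rw [← sum_filter, sum_const, nsmul_eq_mul, containedCount]
  simp only [hcount]
  rw [expect_sum_comm]
  refine le_trans ?_ (sum_le_sum fun i _ => expect_exp_containedCount_mul_le_superset F D (D i) ht)
  rw [← sum_mul, sum_sub_distrib, ← mul_sum]
  gcongr

/- The logarithmic derivative in `t` of the left side is at most `Δ * t - M`, with `M` the mean of
the count. -/
theorem expect_exp_neg_mul_containedCount_le
    (hΔ : ∑ i ∈ F, ∑ j ∈ F with ¬ Disjoint (D j) (D i), (2 ^ #(D j ∪ D i) : ℝ)⁻¹ ≤ Δ)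
    {t : ℝ} (ht : 0 ≤ t) :
    𝔼 A, Real.exp (-t * containedCount F D A) ≤
      Real.exp (Δ * t ^ 2 / 2 - t * ∑ i ∈ F, (2 ^ #(D i) : ℝ)⁻¹) := by
  set M := ∑ i ∈ F, (2 ^ #(D i) : ℝ)⁻¹
  set f : ℝ → ℝ := fun t => 𝔼 A, Real.exp (-t * containedCount F D A) with hfdef
  have hf (u : ℝ) : HasDerivAt f
      (-𝔼 A, containedCount F D A * Real.exp (-u * containedCount F D A)) u := by
    simp only [hfdef, Fintype.expect_eq_sum_div_card, ← neg_div, ← sum_neg_distrib]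
    refine (HasDerivAt.fun_sum fun A _ => ?_).div_const _
    exact ((hasDerivAt_id u).neg.mul_const _).exp.congr_deriv (by simp; ring)
  have hc (u : ℝ) : HasDerivAt (fun u => Δ * u ^ 2 / 2 - u * M) (Δ * u - M) u :=
    ((((hasDerivAt_pow 2 u).const_mul Δ).div_const 2).sub
      ((hasDerivAt_id u).mul_const M)).congr_deriv (by norm_num; ring)
  have h := le_mul_exp_of_hasDerivAt_le hf hc (fun u hu => ?_) ht
  · simpa [hfdef] using h
  · linarith [expect_containedCount_mul_exp_ge hΔ hu]

theorem janson
    (hΔ : ∑ i ∈ F, ∑ j ∈ F with ¬ Disjoint (D j) (D i), (2 ^ #(D j ∪ D i) : ℝ)⁻¹ ≤ Δ) :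
    randomSubsetProb {A : Set G | ∀ i ∈ F, ¬ (D i : Set G) ⊆ A} ≤
      Real.exp (-((∑ i ∈ F, (2 ^ #(D i) : ℝ)⁻¹) ^ 2 / (2 * Δ))) := by
  set M := ∑ i ∈ F, (2 ^ #(D i) : ℝ)⁻¹
  have hΔ0 : 0 ≤ Δ := (sum_nonneg fun _ _ => sum_nonneg fun _ _ => by positivity).trans hΔ
  have hM0 : 0 ≤ M := sum_nonneg fun _ _ => by positivity
  calc randomSubsetProb {A : Set G | ∀ i ∈ F, ¬ (D i : Set G) ⊆ A}
      ≤ 𝔼 A, Real.exp (-(M / Δ) * containedCount F D A) := by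
        rw [randomSubsetProb_eq_expect]
        refine expect_le_expect fun A _ => Set.indicator_apply_le' (fun hA => ?_)
          fun _ => (Real.exp_pos _).le
        have : containedCount F D A = 0 :=
          card_eq_zero.2 <| filter_eq_empty_iff.2 fun i hi h => hA i hi (coe_subset.2 h)
        simp [this]
    _ ≤ Real.exp (Δ * (M / Δ) ^ 2 / 2 - M / Δ * M) :=
        expect_exp_neg_mul_containedCount_le hΔ (div_nonneg hM0 hΔ0)
    _ = Real.exp (-(M ^ 2 / (2 * Δ))) := by
        rcases eq_or_ne Δ 0 with rfl | hne
        · simp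
        · congr 1; field_simp; ring

theorem janson_of_card_eq {K : ℕ} (hK : ∀ i ∈ F, #(D i) = K)
    (hΔ : ∑ i ∈ F, ∑ j ∈ F with ¬ Disjoint (D j) (D i), (2 ^ #(D j ∩ D i) : ℝ) ≤ Δ) :
    randomSubsetProb {A : Set G | ∀ i ∈ F, ¬ (D i : Set G) ⊆ A} ≤
      Real.exp (-((#F : ℝ) ^ 2 / (2 * Δ))) := by
  have hM : ∑ i ∈ F, (2 ^ #(D i) : ℝ)⁻¹ = #F * (2 ^ K)⁻¹ := by
    rw [sum_congr rfl fun i hi => by rw [hK i hi], sum_const, nsmul_eq_mul]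
  have hunion : ∑ i ∈ F, ∑ j ∈ F with ¬ Disjoint (D j) (D i), (2 ^ #(D j ∪ D i) : ℝ)⁻¹ ≤
      ((2 ^ K)⁻¹) ^ 2 * Δ := by
    refine le_trans (le_of_eq ?_) (mul_le_mul_of_nonneg_left hΔ (by positivity))
    simp only [mul_sum]
    refine sum_congr rfl fun i hi => sum_congr rfl fun j hj => ?_
    have : #(D j ∪ D i) + #(D j ∩ D i) = K + K := by
      rw [card_union_add_card_inter, hK i hi, hK j (mem_filter.1 hj).1]
    rw [inv_eq_iff_eq_inv, mul_inv, ← inv_pow, inv_inv, eq_mul_inv_iff_mul_eq₀ (by positivity),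
      ← pow_add, this, pow_add, sq]
  refine (janson hunion).trans_eq ?_
  rw [hM, mul_pow, mul_left_comm, mul_comm (#F ^ 2 : ℝ), mul_div_mul_left _ _ (by positivity)]

end Janson

section Forest

variable {V : Type*} (H : SimpleGraph V)

/-- A chosen representative of the connected component of `v`, the root of a spanning tree of that
component. -/
noncomputable def componentRoot (v : V) : V := (H.connectedComponentMk v).out

variable {H}

theorem reachable_componentRoot (v : V) : H.Reachable v (componentRoot H v) :=
  (SimpleGraph.ConnectedComponent.eq.1 (Quot.out_eq (H.connectedComponentMk v))).symm

theorem componentRoot_eq_of_adj {v w : V} (h : H.Adj v w) :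
    componentRoot H v = componentRoot H w := by
  rw [componentRoot, SimpleGraph.ConnectedComponent.eq.2 h.reachable, componentRoot]

theorem exists_adj_dist_componentRoot_lt {v : V} (hv : componentRoot H v ≠ v) :
    ∃ w, H.Adj v w ∧ H.dist w (componentRoot H w) < H.dist v (componentRoot H v) := by
  obtain ⟨p, hp⟩ := (reachable_componentRoot (H := H) v).exists_walk_length_eq_dist
  have hnil : ¬ p.Nil := fun h => hv h.eq.symm
  have hadj := p.adj_snd hnil
  refine ⟨p.snd, hadj, ?_⟩
  rw [← componentRoot_eq_of_adj hadj, ← hp, ← p.length_tail_add_one hnil]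
  exact Nat.lt_succ_of_le (SimpleGraph.dist_le p.tail)

variable (H) [Fintype V] [DecidableEq V]

/-- The vertices that do not represent their connected component. Their number is the rank of the
graph, the number of edges of a spanning forest. -/
noncomputable def nonRoots : Finset V := {v | componentRoot H v ≠ v}

variable {H}

theorem mem_nonRoots {v : V} : v ∈ nonRoots H ↔ componentRoot H v ≠ v := by simp [nonRoots]

theorem eq_componentRoot_of_adj_of_notMem_nonRoots {v w : V} (h : H.Adj v w)
    (hv : v ∉ nonRoots H) : v = componentRoot H w := by
  rw [mem_nonRoots, not_not] at hv
  rw [← componentRoot_eq_of_adj h, hv]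

theorem card_edgeFinset_le_choose_card_nonRoots [DecidableRel H.Adj] :
    #H.edgeFinset ≤ (#(nonRoots H) + 1).choose 2 := by
  have hsub : H.edgeFinset ⊆ (nonRoots H).offDiag.image Sym2.mk.uncurry ∪
      (nonRoots H).image fun v => s(v, componentRoot H v) := by
    intro e he
    induction e with | _ v w
    have hadj : H.Adj v w := SimpleGraph.mem_edgeFinset.1 he
    rw [mem_union, mem_image, mem_image]
    by_cases hv : v ∈ nonRoots H
    · by_cases hw : w ∈ nonRoots H
      · exact Or.inl ⟨(v, w), mem_offDiag.2 ⟨hv, hw, hadj.ne⟩, rfl⟩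
      · exact Or.inr ⟨v, hv,
          by rw [← eq_componentRoot_of_adj_of_notMem_nonRoots hadj.symm hw]⟩
    · have hvw := eq_componentRoot_of_adj_of_notMem_nonRoots hadj hv
      refine Or.inr ⟨w, mem_nonRoots.2 fun h => hadj.ne (hvw.trans h), ?_⟩
      rw [← hvw, Sym2.eq_swap]
  calc #H.edgeFinset ≤ _ := card_le_card hsub
    _ ≤ _ := card_union_le _ _
    _ ≤ (#(nonRoots H)).choose 2 + #(nonRoots H) :=
        add_le_add (Sym2.card_image_offDiag _).le card_image_le
    _ = (#(nonRoots H) + 1).choose 2 := by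
        rw [Nat.choose_succ_succ' _ 1, Nat.choose_one_right, add_comm]

end Forest

section Colouring

variable {V ι : Type*} {H : SimpleGraph V}

theorem colorable_induce_succ_of_sdiff [DecidableEq V] {X P : Finset V} {n : ℕ}
    (hX : H.IsIndepSet X) (hP : (H.induce (P \ X : Finset V)).Colorable n) :
    (H.induce (P : Set V)).Colorable (n + 1) := by
  obtain ⟨C⟩ := hP
  let C' (v : ↥(P : Set V)) : Option (Fin n) := if hv : (v : V) ∈ X then none else
    some (C ⟨v, mem_sdiff.2 ⟨v.2, hv⟩⟩)
  refine (SimpleGraph.Coloring.mk C' fun {v w} hvw => ?_).colorable.mono (by simp)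
  by_cases hv : (v : V) ∈ X <;> by_cases hw : (w : V) ∈ X
  · exact absurd hvw (hX hv hw (Subtype.coe_injective.ne hvw.ne))
  · simp [C', hv, hw]
  · simp [C', hv, hw]
  · simpa [C', hv, hw] using C.valid (v := ⟨v, mem_sdiff.2 ⟨v.2, hv⟩⟩)
      (w := ⟨w, mem_sdiff.2 ⟨w.2, hw⟩⟩) hvw

theorem colorable_induce_of_forall_exists_isNIndepSet {k s : ℕ} (hk : 0 < k) (P : Finset V)
    (h : ∀ S ⊆ P, #S = s → ∃ X ⊆ S, H.IsNIndepSet k X) :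
    (H.induce (P : Set V)).Colorable (#P / k + s) := by
  classical
  induction P using Finset.strongInduction with
  | H P ih =>
    rcases le_or_gt #P s with hP | hP
    · exact (H.induce (P : Set V)).colorable_of_fintype.mono
        (by simpa using hP.trans (Nat.le_add_left s _))
    · obtain ⟨S, hSP, hS⟩ := exists_subset_card_eq hP.le
      obtain ⟨X, hXS, hX⟩ := h S hSP hS
      have hXP := hXS.trans hSP
      have hXne : X.Nonempty := card_pos.1 (hX.card_eq ▸ hk)
      have hrec := ih (P \ X) (sdiff_ssubset hXP hXne) fun S' hS' => h S' (hS'.trans sdiff_subset)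
      refine (colorable_induce_succ_of_sdiff hX.isIndepSet hrec).mono (le_of_eq ?_)
      have hkP : k ≤ #P := hX.card_eq ▸ card_le_card hXP
      rw [card_sdiff_of_subset hXP, hX.card_eq, Nat.div_eq_sub_div hk hkP, add_right_comm]

/-- The colour class of `i` under `f`. -/
def fibre [Fintype V] [DecidableEq ι] (f : V → ι) (i : ι) : Finset V := {v | f v = i}

variable [Fintype ι] [DecidableEq ι]

theorem colorable_of_colorable_induce_fibre [Fintype V] (f : V → ι) {n : ι → ℕ}
    (h : ∀ i, (H.induce (fibre f i : Set V)).Colorable (n i)) : H.Colorable (∑ i, n i) := by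
  let C (i : ι) := (h i).some
  have hmem (v : V) : v ∈ (fibre f (f v) : Set V) := by simp [fibre]
  refine (SimpleGraph.Coloring.mk (fun v => (⟨f v, C (f v) ⟨v, hmem v⟩⟩ : Σ i, Fin (n i)))
    fun {v w} hvw => ?_).colorable.mono (by simp)
  have hne (i j : ι) (hv : v ∈ (fibre f i : Set V)) (hw : w ∈ (fibre f j : Set V)) :
      (⟨i, C i ⟨v, hv⟩⟩ : Σ i, Fin (n i)) ≠ ⟨j, C j ⟨w, hw⟩⟩ := fun heq => by
    obtain rfl : i = j := congrArg Sigma.fst heq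
    exact (C i).valid (v := ⟨v, hv⟩) (w := ⟨w, hw⟩) hvw (eq_of_heq (Sigma.mk.inj heq).2)
  exact hne _ _ _ _

theorem sum_card_fibre [Fintype V] (f : V → ι) : ∑ i, #(fibre f i) = Fintype.card V :=
  (card_eq_sum_card_fiberwise fun v _ => mem_univ (f v)).symm

theorem colorable_of_forall_exists_isNIndepSet_fibre [Fintype V] {k s : ℕ} (hk : 0 < k)
    (f : V → ι) (I : Finset ι)
    (h : ∀ i ∈ I, ∀ S ⊆ fibre f i, #S = s → ∃ X ⊆ S, H.IsNIndepSet k X) :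
    H.Colorable (Fintype.card V / k + Fintype.card ι * s + ∑ i ∈ Iᶜ, #(fibre f i)) := by
  have hfibre (i : ι) : (H.induce (fibre f i : Set V)).Colorable
      (#(fibre f i) / k + s + if i ∈ Iᶜ then #(fibre f i) else 0) := by
    by_cases hi : i ∈ I
    · simpa [hi] using colorable_induce_of_forall_exists_isNIndepSet hk _ (h i hi)
    · exact (SimpleGraph.colorable_of_fintype _).mono (by simp [hi])
  refine (colorable_of_colorable_induce_fibre f hfibre).mono ?_
  rw [sum_add_distrib, sum_add_distrib, ← sum_card_fibre f]
  gcongr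
  · rw [Nat.le_div_iff_mul_le hk, sum_mul]
    exact sum_le_sum fun i _ => Nat.div_mul_le_self _ _
  · simp
  · rw [sum_ite_mem, univ_inter]

theorem exists_surjective_coloring [Fintype V] {n r : ℕ} (h : H.Colorable n) (hn : n ≤ r)
    (hr : r ≤ Fintype.card V) : ∃ C : H.Coloring (Fin r), Function.Surjective C := by
  classical
  obtain ⟨C⟩ := h.mono hn
  have hrange : #(univ.image (Set.rangeSplitting C)) ≤ r :=
    card_image_le.trans <| card_univ.trans_le <|
      (set_fintype_card_le_univ _).trans_eq (Fintype.card_fin r)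
  obtain ⟨R, hsub, -, hR⟩ := exists_subsuperset_card_eq (subset_univ _) hrange
    (by rwa [card_univ])
  set ρ : V → R := fun v => if hv : v ∈ R then ⟨v, hv⟩ else
    ⟨Set.rangeSplitting C ⟨C v, v, rfl⟩, hsub (mem_image_of_mem _ (mem_univ _))⟩ with hρ
  have hρR (v : R) : ρ v = v := by simp [hρ]
  have hCρ (v : V) : C (ρ v) = C v := by
    by_cases hv : v ∈ R <;> simp [hρ, hv, Set.apply_rangeSplitting]
  refine ⟨SimpleGraph.Coloring.mk (fun v => R.equivFinOfCardEq hR (ρ v)) fun {v w} hvw heq => ?_,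
    fun i => ⟨(R.equivFinOfCardEq hR).symm i, ?_⟩⟩
  · refine C.valid hvw ?_
    rw [← hCρ v, ← hCρ w, (R.equivFinOfCardEq hR).injective heq]
  · exact (congrArg _ (hρR _)).trans (Equiv.apply_symm_apply _ i)

end Colouring

section CayleySumGraph

variable {G : Type*} [AddCommGroup G] {A : Set G} {X : Set G}

theorem isIndepSet_cayleySumGraph_compl :
    (cayleySumGraph Aᶜ).IsIndepSet X ↔ restrictedSumset X ⊆ A := by
  constructor
  · rintro h _ ⟨x, hx, y, hy, hne, rfl⟩
    by_contra hA
    exact h hx hy hne ⟨hne, hA⟩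
  · exact fun h x hx y hy hne hadj => hadj.2 (h ⟨x, hx, y, hy, hne, rfl⟩)

theorem exists_isPartitionInto_of_colorable [Fintype G] {n r : ℕ}
    (h : (cayleySumGraph Aᶜ).Colorable n) (hn : n ≤ r) (hr : r ≤ Fintype.card G) :
    ∃ X : Fin r → Set G, IsPartitionInto r X ∧ ∀ i, restrictedSumset (X i) ⊆ A := by
  obtain ⟨C, hC⟩ := exists_surjective_coloring h hn hr
  exact ⟨C.colorClass,
    { nonempty := hC
      disjoint := fun i j hij => Set.disjoint_left.2 fun x hi hj => hij (hi.symm.trans hj)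
      cover := Set.eq_univ_of_forall fun x => Set.mem_iUnion.2 ⟨C x, rfl⟩ },
    fun i => isIndepSet_cayleySumGraph_compl.1 (C.isIndepSet_colorClass i)⟩

end CayleySumGraph

theorem exists_chromaticNumber_eq_of_colorable {V : Type*} {H : SimpleGraph V} {n : ℕ}
    (h : H.Colorable n) : ∃ k : ℕ, H.chromaticNumber = k ∧ k ≤ n := by
  obtain ⟨k, hk⟩ := ENat.ne_top_iff_exists.1
    (ne_top_of_le_ne_top (ENat.natCast_ne_top n) h.chromaticNumber_le)
  exact ⟨k, hk.symm, Nat.cast_le.1 (hk.le.trans h.chromaticNumber_le)⟩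

section Tuples

theorem card_le_pow_of_forall_eq_compl {ι α : Type*} [Fintype ι] {S : Finset α}
    {Y : Finset (ι → α)} (C : Finset ι) (hY : ∀ x ∈ Y, ∀ i, x i ∈ S)
    (hinj : ∀ x ∈ Y, ∀ y ∈ Y, (∀ i ∉ C, x i = y i) → x = y) :
    #Y ≤ #S ^ (Fintype.card ι - #C) := by
  classical
  have hcard : #(Fintype.piFinset fun _ : ↥(Cᶜ) => S) = #S ^ (Fintype.card ι - #C) := by
    simp [card_compl]
  rw [← hcard]
  refine card_le_card_of_injOn (fun x i => x i) (fun x hx => ?_) fun x hx y hy h => ?_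
  · exact mem_coe.2 <| Fintype.mem_piFinset.2 fun i => hY x hx i
  · exact hinj x hx y hy fun i hi => congrFun h ⟨i, mem_compl.2 hi⟩

variable {G ι : Type*} [AddCommGroup G]

/-- The sum of the two entries of `x` at an unordered pair of indices. -/
def pairSum (x : ι → G) : Sym2 ι → G :=
  Sym2.lift ⟨fun i j => x i + x j, fun _ _ => add_comm _ _⟩

@[simp]
theorem pairSum_mk (x : ι → G) (i j : ι) : pairSum x s(i, j) = x i + x j := rfl

theorem injective_of_injOn_pairSum [Fintype ι] {x : ι → G} (hι : 2 < Fintype.card ι)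
    (hx : Set.InjOn (pairSum x) (⊤ : SimpleGraph ι).edgeSet) : Function.Injective x := by
  classical
  intro i j hij
  by_contra hne
  obtain ⟨l, -, hl⟩ := exists_mem_notMem_of_card_lt_card (s := {i, j}) (t := univ)
    (card_le_two.trans_lt (card_univ (α := ι) ▸ hι))
  simp only [mem_insert, mem_singleton, not_or] at hl
  have h : s(i, l) = s(j, l) := hx (by simpa using Ne.symm hl.1) (by simpa using Ne.symm hl.2)
    (by simp [hij])
  exact hne (Sym2.congr_left.1 h)

variable [Fintype ι] [DecidableEq ι]

/-- The set of sums `x i + x j` with `i ≠ j`. -/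
def pairSums [DecidableEq G] (x : ι → G) : Finset G :=
  (⊤ : SimpleGraph ι).edgeFinset.image (pairSum x)

theorem card_edgeFinset_top_le : #(⊤ : SimpleGraph ι).edgeFinset ≤ Fintype.card ι ^ 2 := by
  rw [SimpleGraph.card_edgeFinset_top_eq_card_choose_two]
  exact Nat.choose_le_pow _ _

theorem card_pairSums_le [DecidableEq G] (x : ι → G) : #(pairSums x) ≤ Fintype.card ι ^ 2 :=
  card_image_le.trans card_edgeFinset_top_le

open Classical in
/-- The tuples with entries in `S` for which the sums of different pairs of entries are
different. -/
noncomputable def genericTuples (ι : Type*) [Fintype ι] [DecidableEq ι] (S : Finset G) :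
    Finset (ι → G) :=
  {x ∈ Fintype.piFinset fun _ => S | Set.InjOn (pairSum x) (⊤ : SimpleGraph ι).edgeSet}

variable {S : Finset G} {x : ι → G}

theorem mem_genericTuples : x ∈ genericTuples ι S ↔
    (∀ i, x i ∈ S) ∧ Set.InjOn (pairSum x) (⊤ : SimpleGraph ι).edgeSet := by
  classical
  rw [genericTuples, mem_filter, Fintype.mem_piFinset]

theorem genericTuples_subset_piFinset (S : Finset G) :
    genericTuples ι S ⊆ Fintype.piFinset fun _ => S := fun _ hx =>
  Fintype.mem_piFinset.2 (mem_genericTuples.1 hx).1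

theorem card_pairSums_of_mem_genericTuples [DecidableEq G] (hx : x ∈ genericTuples ι S) :
    #(pairSums x) = (Fintype.card ι).choose 2 := by
  rw [pairSums, card_image_of_injOn, SimpleGraph.card_edgeFinset_top_eq_card_choose_two]
  simpa using (mem_genericTuples.1 hx).2

theorem card_pairSum_eq_pairSum_le [DecidableEq G] (S : Finset G) {e f : Sym2 ι}
    (he : e ∈ (⊤ : SimpleGraph ι).edgeSet) (hf : f ∈ (⊤ : SimpleGraph ι).edgeSet) (hef : e ≠ f) :
    #{x ∈ Fintype.piFinset fun _ => S | pairSum x e = pairSum x f} ≤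
      #S ^ (Fintype.card ι - 1) := by
  obtain ⟨i, hie, hif⟩ : ∃ i ∈ e, i ∉ f := by
    by_contra! hall
    induction e with | _ a b
    have hab : a ≠ b := by simpa using he
    exact hef ((Sym2.mem_and_mem_iff hab).1 ⟨hall a (by simp), hall b (by simp)⟩).symm
  obtain ⟨j, rfl⟩ := hie
  have hj : j ≠ i := by rintro rfl; simp at he
  rw [← card_singleton i]
  refine card_le_pow_of_forall_eq_compl _ (fun x hx => Fintype.mem_piFinset.1 (mem_filter.1 hx).1)
    fun x hx y hy h => ?_
  simp only [mem_singleton] at h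
  have hf' : pairSum x f = pairSum y f := by
    induction f with | _ c d
    simp only [Sym2.mem_iff, not_or] at hif
    rw [pairSum_mk, pairSum_mk, h c (Ne.symm hif.1), h d (Ne.symm hif.2)]
  have hi : x i + x j = y i + y j :=
    (mem_filter.1 hx).2.trans (hf'.trans (mem_filter.1 hy).2.symm)
  rw [h j hj] at hi
  exact funext fun l => if hl : l = i then hl ▸ add_right_cancel hi else h l hl

theorem card_pow_le_two_mul_card_genericTuples [Nonempty ι] (hS : 2 * Fintype.card ι ^ 4 ≤ #S) :
    #S ^ Fintype.card ι ≤ 2 * #(genericTuples ι S) := by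
  classical
  set k := Fintype.card ι
  set P := (⊤ : SimpleGraph ι).edgeFinset
  set bad : Finset (ι → G) := {x ∈ Fintype.piFinset fun _ => S |
    ¬ Set.InjOn (pairSum x) (⊤ : SimpleGraph ι).edgeSet}
  have hsub : bad ⊆ P.offDiag.biUnion fun p =>
      {x ∈ Fintype.piFinset fun _ => S | pairSum x p.1 = pairSum x p.2} := fun x hx => by
    obtain ⟨hxS, hx⟩ := mem_filter.1 hx
    simp only [Set.InjOn, not_forall] at hx
    obtain ⟨e, he, f, hf, h, hne⟩ := hx
    exact mem_biUnion.2 ⟨(e, f), mem_offDiag.2 ⟨by simpa [P] using he, by simpa [P] using hf, hne⟩,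
      mem_filter.2 ⟨hxS, h⟩⟩
  have hbad : #bad ≤ k ^ 4 * #S ^ (k - 1) := by
    refine (card_le_card hsub).trans ((card_biUnion_le_card_mul _ _ (#S ^ (k - 1))
      fun p hp => ?_).trans (Nat.mul_le_mul_right _ ?_))
    · obtain ⟨he, hf, hne⟩ := mem_offDiag.1 hp
      exact card_pairSum_eq_pairSum_le S (SimpleGraph.mem_edgeFinset.1 he)
        (SimpleGraph.mem_edgeFinset.1 hf) hne
    · calc #P.offDiag ≤ #P * #P := offDiag_card P ▸ Nat.sub_le _ _
        _ ≤ k ^ 2 * k ^ 2 := Nat.mul_le_mul card_edgeFinset_top_le card_edgeFinset_top_le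
        _ = k ^ 4 := by ring
  have htotal : #(genericTuples ι S) + #bad = #S ^ k :=
    (card_filter_add_card_filter_not _).trans (by simp [k])
  have hpow : 2 * (k ^ 4 * #S ^ (k - 1)) ≤ #S ^ k := by
    calc 2 * (k ^ 4 * #S ^ (k - 1)) ≤ #S * #S ^ (k - 1) := by rw [← mul_assoc]; gcongr
      _ = #S ^ k := mul_pow_sub_one Fintype.card_ne_zero _
  omega

theorem card_pairSum_eq_le_addEnergy_mul [DecidableEq G] (S : Finset G) {e f : Sym2 ι}
    (he : e ∈ (⊤ : SimpleGraph ι).edgeSet) (hf : f ∈ (⊤ : SimpleGraph ι).edgeSet) :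
    #{z ∈ (Fintype.piFinset fun _ => S) ×ˢ (Fintype.piFinset fun _ => S) |
        pairSum z.1 e = pairSum z.2 f} ≤ (#S ^ (Fintype.card ι - 2)) ^ 2 * E[S] := by
  induction e with | _ a b
  induction f with | _ c d
  have hfix {a b : ι} (hab : a ≠ b) (u v : G) :
      #{x ∈ Fintype.piFinset fun _ : ι => S | x a = u ∧ x b = v} ≤
        #S ^ (Fintype.card ι - 2) := by
    rw [← card_pair hab]
    refine card_le_pow_of_forall_eq_compl _
      (fun x hx => Fintype.mem_piFinset.1 (mem_filter.1 hx).1) fun x hx y hy h => ?_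
    have hx := (mem_filter.1 hx).2
    have hy := (mem_filter.1 hy).2
    grind
  refine card_le_mul_card_image_of_maps_to
    (f := fun z : (ι → G) × (ι → G) => ((z.1 a, z.2 c), (z.1 b, z.2 d))) (fun z hz => ?_) _
    fun q _ => ?_
  · simp only [mem_filter, mem_product, Fintype.mem_piFinset] at hz ⊢
    exact ⟨⟨⟨hz.1.1 a, hz.1.2 c⟩, hz.1.1 b, hz.1.2 d⟩, hz.2⟩
  · calc _ ≤ #({x ∈ Fintype.piFinset fun _ : ι => S | x a = q.1.1 ∧ x b = q.2.1} ×ˢ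
            {y ∈ Fintype.piFinset fun _ : ι => S | y c = q.1.2 ∧ y d = q.2.2}) := by
          refine card_le_card fun z hz => ?_
          simp only [mem_filter, mem_product] at hz ⊢
          obtain ⟨⟨hz, -⟩, rfl⟩ := hz
          exact ⟨⟨hz.1, rfl, rfl⟩, hz.2, rfl, rfl⟩
      _ ≤ (#S ^ (Fintype.card ι - 2)) ^ 2 := by
          rw [card_product, sq]
          exact Nat.mul_le_mul (hfix he _ _) (hfix hf _ _)

end Tuples

section Overlap

variable {G ι : Type*} [AddCommGroup G]

theorem eq_of_add_parent_eq {R : Set ι} {d : ι → ℕ} {π : ι → ι} {y z : ι → G}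
    (hd : ∀ i ∈ R, d (π i) < d i) (hR : ∀ i ∈ R, y i + y (π i) = z i + z (π i))
    (hRc : ∀ i ∉ R, y i = z i) : y = z := by
  have hrec (n : ℕ) : ∀ i, d i = n → y i = z i := by
    induction n using Nat.strong_induction_on with
    | _ n ih =>
      intro i hi
      by_cases hiR : i ∈ R
      · have hpar := ih _ (hi ▸ hd i hiR) _ rfl
        have hsum := hR i hiR
        rw [hpar] at hsum
        exact add_right_cancel hsum
      · exact hRc i hiR
  exact funext fun i => hrec _ i rfl

/-- The graph on the indices of a tuple `y` joining `i` and `j` when `y i` and `y j` are joined in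
the Cayley sum graph of `T`. For `T = pairSums x`, its edges are the coincidences between sums of
`y` and sums of `x`. -/
def overlapGraph (T : Finset G) (y : ι → G) : SimpleGraph ι := (cayleySumGraph (T : Set G)).comap y

variable [Fintype ι] [DecidableEq ι]

/- Follow each non-root to a neighbour closer to its root. These neighbours, the sums along the
edges to them, which lie in `T`, and the entries at the roots determine the tuple. -/
theorem card_nonRoots_overlapGraph_eq_le (S T : Finset G) (R : Finset ι) :
    #{y ∈ Fintype.piFinset fun _ => S | nonRoots (overlapGraph T y) = R} ≤
      (Fintype.card ι * #T) ^ #R * #S ^ (Fintype.card ι - #R) := by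
  have hcard : #((Fintype.piFinset fun _ : R => (univ : Finset ι) ×ˢ T) ×ˢ
      (Fintype.piFinset fun _ : ↥(Rᶜ) => S)) =
        (Fintype.card ι * #T) ^ #R * #S ^ (Fintype.card ι - #R) := by
    simp [card_compl]
  let d (y : ι → G) (i : ι) : ℕ := (overlapGraph T y).dist i (componentRoot (overlapGraph T y) i)
  have hparent (y : ι → G) (i : ι) : ∃ j, i ∈ nonRoots (overlapGraph T y) →
      (overlapGraph T y).Adj i j ∧ d y j < d y i := by
    by_cases hi : i ∈ nonRoots (overlapGraph T y)
    · obtain ⟨j, hj⟩ := exists_adj_dist_componentRoot_lt (mem_nonRoots.1 hi)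
      exact ⟨j, fun _ => hj⟩
    · exact ⟨i, fun h => absurd h hi⟩
  choose π hπ using hparent
  rw [← hcard]
  refine card_le_card_of_injOn (fun y => (fun i => (π y i, y i + y (π y i)), fun i => y i))
    (fun y hy => ?_) fun y hy z hz hyz => ?_
  · obtain ⟨hyS, rfl⟩ := mem_filter.1 hy
    simp only [mem_coe, mem_product, Fintype.mem_piFinset, mem_univ, true_and]
    exact ⟨fun i => (hπ y i i.2).1.2, fun i => Fintype.mem_piFinset.1 hyS i⟩
  · obtain ⟨-, rfl⟩ := mem_filter.1 hy
    have hpar (i : ι) (hi : i ∈ nonRoots (overlapGraph T y)) :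
        π y i = π z i ∧ y i + y (π y i) = z i + z (π z i) :=
      Prod.ext_iff.1 <| congrFun (congrArg Prod.fst hyz) ⟨i, hi⟩
    refine eq_of_add_parent_eq (R := nonRoots (overlapGraph T y)) (d := d y) (π := π y)
      (fun i hi => (hπ y i hi).2) (fun i hi => ?_) fun i hi => ?_
    · rw [(hpar i hi).2, (hpar i hi).1]
    · exact congrFun (congrArg Prod.snd hyz) ⟨i, mem_compl.2 hi⟩

theorem card_card_nonRoots_overlapGraph_eq_le (S : Finset G) {T : Finset G}
    (hT : #T ≤ Fintype.card ι ^ 2) (r : ℕ) :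
    #{y ∈ Fintype.piFinset fun _ : ι => S | #(nonRoots (overlapGraph T y)) = r} ≤
      Fintype.card ι ^ (4 * r) * #S ^ (Fintype.card ι - r) := by
  set k := Fintype.card ι
  have hmaps (y) (hy : y ∈ ({y ∈ Fintype.piFinset fun _ : ι => S |
      #(nonRoots (overlapGraph T y)) = r} : Finset (ι → G))) :
      nonRoots (overlapGraph T y) ∈ powersetCard r univ :=
    mem_powersetCard.2 ⟨subset_univ _, (mem_filter.1 hy).2⟩
  refine (card_le_mul_card_image_of_maps_to hmaps ((k * #T) ^ r * #S ^ (k - r))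
    fun R hR => ?_).trans ?_
  · rw [← (mem_powersetCard.1 hR).2]
    refine (card_le_card fun y hy => ?_).trans (card_nonRoots_overlapGraph_eq_le S T R)
    simp only [mem_filter] at hy ⊢
    exact ⟨hy.1.1, hy.2⟩
  · calc (k * #T) ^ r * #S ^ (k - r) * #(powersetCard r (univ : Finset ι))
        ≤ (k * k ^ 2) ^ r * #S ^ (k - r) * k ^ r := by
          rw [card_powersetCard, card_univ]
          gcongr
          exact Nat.choose_le_pow k r
      _ = k ^ (4 * r) * #S ^ (k - r) := by rw [mul_right_comm, ← mul_pow, pow_mul]; ring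

theorem two_pow_mul_pow_mul_le_pow {k N s r : ℕ} (hN : N ≤ 2 ^ k)
    (hs : 2 ^ (k + 3) * k ^ 10 ≤ s ^ 2) (hr : 2 ≤ r) (hrk : r ≤ k) :
    2 ^ (r + 1).choose 2 * k ^ (4 * r) * (k * N) ≤ s ^ r := by
  have hchoose : (r + 1).choose 2 * 2 = r * (r + 1) := by
    rw [Nat.choose_two_right, Nat.div_mul_cancel (Nat.even_mul_pred_self _).two_dvd, mul_comm]
    simp
  have hexp : (r + 1).choose 2 * 2 + k * 2 ≤ (k + 3) * r := by
    obtain ⟨a, rfl⟩ := Nat.exists_eq_add_of_le hr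
    obtain ⟨b, rfl⟩ := Nat.exists_eq_add_of_le hrk
    rw [hchoose]
    nlinarith [Nat.zero_le (a * b)]
  refine (Nat.pow_le_pow_iff_left two_ne_zero).1 ?_
  calc (2 ^ (r + 1).choose 2 * k ^ (4 * r) * (k * N)) ^ 2
      ≤ (2 ^ (r + 1).choose 2 * k ^ (4 * r) * (k * 2 ^ k)) ^ 2 := by gcongr
    _ = 2 ^ ((r + 1).choose 2 * 2 + k * 2) * k ^ (8 * r + 2) := by ring
    _ ≤ 2 ^ ((k + 3) * r) * k ^ (10 * r) := by
        gcongr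
        · exact one_le_two
        · omega
        · omega
    _ = (2 ^ (k + 3) * k ^ 10) ^ r := by rw [mul_pow, ← pow_mul, ← pow_mul]
    _ ≤ (s ^ 2) ^ r := by gcongr
    _ = (s ^ r) ^ 2 := pow_right_comm s 2 r

theorem sum_filter_two_le_card_nonRoots_le [Nonempty ι] {S T : Finset G} {N : ℕ}
    (hT : #T ≤ Fintype.card ι ^ 2) (hN : N ≤ 2 ^ Fintype.card ι)
    (hS : 2 ^ (Fintype.card ι + 3) * Fintype.card ι ^ 10 ≤ #S ^ 2) :
    N * ∑ y ∈ Fintype.piFinset fun _ : ι => S with 2 ≤ #(nonRoots (overlapGraph T y)),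
      2 ^ (#(nonRoots (overlapGraph T y)) + 1).choose 2 ≤ #S ^ Fintype.card ι := by
  set k := Fintype.card ι
  set Y := {y ∈ Fintype.piFinset fun _ : ι => S | 2 ≤ #(nonRoots (overlapGraph T y))}
  have hrank (y) (hy : y ∈ Y) : #(nonRoots (overlapGraph T y)) ∈ Icc 2 k :=
    mem_Icc.2 ⟨(mem_filter.1 hy).2, card_le_univ _⟩
  have hterm (r) (hr : r ∈ Icc 2 k) :
      k * N * ∑ y ∈ Y with #(nonRoots (overlapGraph T y)) = r,
        2 ^ (#(nonRoots (overlapGraph T y)) + 1).choose 2 ≤ #S ^ k := by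
    obtain ⟨h2r, hrk⟩ := mem_Icc.1 hr
    calc k * N * ∑ y ∈ Y with #(nonRoots (overlapGraph T y)) = r,
          2 ^ (#(nonRoots (overlapGraph T y)) + 1).choose 2
        ≤ k * N * (k ^ (4 * r) * #S ^ (k - r) * 2 ^ (r + 1).choose 2) := by
          rw [sum_congr rfl fun y hy => by rw [(mem_filter.1 hy).2], sum_const, smul_eq_mul]
          gcongr
          exact (card_le_card (filter_subset_filter _ (filter_subset _ _))).trans
            (card_card_nonRoots_overlapGraph_eq_le S hT r)
      _ = 2 ^ (r + 1).choose 2 * k ^ (4 * r) * (k * N) * #S ^ (k - r) := by ring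
      _ ≤ #S ^ r * #S ^ (k - r) := by gcongr; exact two_pow_mul_pow_mul_le_pow hN hS h2r hrk
      _ = #S ^ k := by rw [← pow_add, Nat.add_sub_cancel' hrk]
  refine Nat.le_of_mul_le_mul_left ?_ (Fintype.card_pos (α := ι))
  rw [← mul_assoc, ← sum_fiberwise_of_maps_to hrank, mul_sum]
  calc _ ≤ ∑ _r ∈ Icc 2 k, #S ^ k := sum_le_sum hterm
    _ ≤ k * #S ^ k := by
        rw [sum_const, Nat.card_Icc, smul_eq_mul]
        gcongr
        omega

variable [DecidableEq G]

theorem card_pairSums_inter_le (T : Finset G) {y : ι → G} (hy : Function.Injective y) :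
    #(pairSums y ∩ T) ≤ (#(nonRoots (overlapGraph T y)) + 1).choose 2 := by
  classical
  refine le_trans ?_ (card_edgeFinset_le_choose_card_nonRoots (H := overlapGraph T y))
  refine (card_le_card fun g hg => ?_).trans (card_image_le (f := pairSum y))
  obtain ⟨hg, hgT⟩ := mem_inter.1 hg
  obtain ⟨e, he, rfl⟩ := mem_image.1 hg
  refine mem_image_of_mem _ (SimpleGraph.mem_edgeFinset.2 ?_)
  induction e with | _ i j
  exact ⟨hy.ne (SimpleGraph.mem_edgeFinset.1 he), hgT⟩

theorem two_pow_card_pairSums_inter_le (T : Finset G) {y : ι → G} (hy : Function.Injective y) :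
    2 ^ #(pairSums y ∩ T) ≤ 2 + if 2 ≤ #(nonRoots (overlapGraph T y)) then
      2 ^ (#(nonRoots (overlapGraph T y)) + 1).choose 2 else 0 := by
  have h := card_pairSums_inter_le T hy
  split_ifs with hr
  · exact (Nat.pow_le_pow_right two_pos h).trans (Nat.le_add_left _ _)
  · have hone : #(pairSums y ∩ T) ≤ 1 :=
      h.trans (Nat.choose_le_choose 2 (Nat.succ_le_of_lt (not_le.1 hr)))
    exact Nat.pow_le_pow_right two_pos hone

theorem card_not_disjoint_pairSums_le (S : Finset G) :
    #{z ∈ (Fintype.piFinset fun _ : ι => S) ×ˢ (Fintype.piFinset fun _ : ι => S) |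
        ¬ Disjoint (pairSums z.2) (pairSums z.1)} ≤
      Fintype.card ι ^ 4 * ((#S ^ (Fintype.card ι - 2)) ^ 2 * E[S]) := by
  set P := (⊤ : SimpleGraph ι).edgeFinset
  have hsub : {z ∈ (Fintype.piFinset fun _ : ι => S) ×ˢ (Fintype.piFinset fun _ : ι => S) |
      ¬ Disjoint (pairSums z.2) (pairSums z.1)} ⊆ (P ×ˢ P).biUnion fun p =>
        {z ∈ (Fintype.piFinset fun _ : ι => S) ×ˢ (Fintype.piFinset fun _ : ι => S) |
          pairSum z.1 p.1 = pairSum z.2 p.2} := fun z hz => by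
    obtain ⟨hzS, hz⟩ := mem_filter.1 hz
    obtain ⟨g, hg2, hg1⟩ := not_disjoint_iff.1 hz
    obtain ⟨f, hf, rfl⟩ := mem_image.1 hg2
    obtain ⟨e, he, hef⟩ := mem_image.1 hg1
    exact mem_biUnion.2 ⟨(e, f), mem_product.2 ⟨he, hf⟩, mem_filter.2 ⟨hzS, hef⟩⟩
  refine (card_le_card hsub).trans ((card_biUnion_le_card_mul _ _ _ fun p hp => ?_).trans
    (Nat.mul_le_mul_right _ ?_))
  · obtain ⟨he, hf⟩ := mem_product.1 hp
    exact card_pairSum_eq_le_addEnergy_mul S (SimpleGraph.mem_edgeFinset.1 he)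
      (SimpleGraph.mem_edgeFinset.1 hf)
  · calc #(P ×ˢ P) ≤ Fintype.card ι ^ 2 * Fintype.card ι ^ 2 := by
          rw [card_product]; exact Nat.mul_le_mul card_edgeFinset_top_le card_edgeFinset_top_le
      _ = Fintype.card ι ^ 4 := by ring

theorem card_pow_four_le_card_mul_addEnergy [Fintype G] (S : Finset G) :
    #S ^ 4 ≤ Fintype.card G * E[S] := by
  calc #S ^ 4 = #S ^ 2 * #S ^ 2 := by ring
    _ ≤ _ := le_card_add_mul_addEnergy S S
    _ ≤ Fintype.card G * E[S] := Nat.mul_le_mul_right _ (card_le_univ _)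

theorem sum_two_pow_card_inter_le (S : Finset G) {x : ι → G} (hι : 2 < Fintype.card ι) :
    ∑ y ∈ genericTuples ι S with ¬ Disjoint (pairSums y) (pairSums x),
        2 ^ #(pairSums y ∩ pairSums x) ≤
      2 * #{y ∈ Fintype.piFinset fun _ : ι => S | ¬ Disjoint (pairSums y) (pairSums x)} +
        ∑ y ∈ Fintype.piFinset fun _ : ι => S with 2 ≤ #(nonRoots (overlapGraph (pairSums x) y)),
          2 ^ (#(nonRoots (overlapGraph (pairSums x) y)) + 1).choose 2 := by
  classical
  have hgen : genericTuples ι S ⊆ Fintype.piFinset fun _ : ι => S :=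
    genericTuples_subset_piFinset S
  calc ∑ y ∈ genericTuples ι S with ¬ Disjoint (pairSums y) (pairSums x),
        2 ^ #(pairSums y ∩ pairSums x)
      ≤ ∑ y ∈ genericTuples ι S with ¬ Disjoint (pairSums y) (pairSums x),
          (2 + if 2 ≤ #(nonRoots (overlapGraph (pairSums x) y)) then
            2 ^ (#(nonRoots (overlapGraph (pairSums x) y)) + 1).choose 2 else 0) :=
        sum_le_sum fun y hy => two_pow_card_pairSums_inter_le _ <|
          injective_of_injOn_pairSum hι (mem_genericTuples.1 (mem_filter.1 hy).1).2
    _ ≤ _ := by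
        rw [sum_add_distrib, sum_const, smul_eq_mul, mul_comm, ← sum_filter]
        exact add_le_add (Nat.mul_le_mul_left _ (card_le_card (filter_subset_filter _ hgen)))
          (sum_le_sum_of_subset (filter_subset_filter _ ((filter_subset _ _).trans hgen)))

theorem card_pow_mul_sum_two_pow_card_inter_le [Fintype G] {S : Finset G}
    (hι : 2 < Fintype.card ι) (hG : Fintype.card G ≤ 2 ^ Fintype.card ι)
    (hS : 2 ^ (Fintype.card ι + 3) * Fintype.card ι ^ 10 ≤ #S ^ 2) :
    #S ^ 4 * ∑ x ∈ genericTuples ι S,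
        ∑ y ∈ genericTuples ι S with ¬ Disjoint (pairSums y) (pairSums x),
          2 ^ #(pairSums y ∩ pairSums x) ≤
      3 * Fintype.card ι ^ 4 * E[S] * (#S ^ Fintype.card ι) ^ 2 := by
  have : Nonempty ι := Fintype.card_pos_iff.1 (by omega)
  set k := Fintype.card ι
  set s := #S
  set Ω := Fintype.piFinset fun _ : ι => S
  have hΩ : #Ω = s ^ k := by simp [Ω, k, s]
  let meet (x : ι → G) : ℕ := #{y ∈ Ω | ¬ Disjoint (pairSums y) (pairSums x)}
  let overlap (x : ι → G) : ℕ :=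
    ∑ y ∈ Ω with 2 ≤ #(nonRoots (overlapGraph (pairSums x) y)),
      2 ^ (#(nonRoots (overlapGraph (pairSums x) y)) + 1).choose 2
  have hmeet : ∑ x ∈ Ω, meet x ≤ k ^ 4 * ((s ^ (k - 2)) ^ 2 * E[S]) := by
    refine le_trans (le_of_eq ?_) (card_not_disjoint_pairSums_le S)
    simp only [meet, card_filter, sum_product, Ω]
  have hoverlap : s ^ 4 * ∑ x ∈ Ω, overlap x ≤ E[S] * (s ^ k) ^ 2 := by
    calc s ^ 4 * ∑ x ∈ Ω, overlap x
        ≤ Fintype.card G * E[S] * ∑ x ∈ Ω, overlap x := by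
          gcongr; exact card_pow_four_le_card_mul_addEnergy S
      _ = E[S] * ∑ x ∈ Ω, Fintype.card G * overlap x := by rw [← mul_sum]; ring
      _ ≤ E[S] * ∑ _x ∈ Ω, s ^ k := by
          gcongr with x
          exact sum_filter_two_le_card_nonRoots_le (card_pairSums_le x) hG hS
      _ = E[S] * (s ^ k) ^ 2 := by rw [sum_const, hΩ, smul_eq_mul, sq]
  calc _ ≤ s ^ 4 * ∑ x ∈ Ω, (2 * meet x + overlap x) := by
        exact Nat.mul_le_mul_left _ ((sum_le_sum fun x _ => sum_two_pow_card_inter_le S hι).trans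
          (sum_le_sum_of_subset (genericTuples_subset_piFinset S)))
    _ = s ^ 4 * (2 * ∑ x ∈ Ω, meet x) + s ^ 4 * ∑ x ∈ Ω, overlap x := by
        rw [sum_add_distrib, mul_sum, mul_add]
    _ ≤ s ^ 4 * (2 * (k ^ 4 * ((s ^ (k - 2)) ^ 2 * E[S]))) + E[S] * (s ^ k) ^ 2 := by gcongr
    _ = (2 * k ^ 4 + 1) * E[S] * (s ^ k) ^ 2 := by
        rw [← Nat.sub_add_cancel hι.le, pow_add, Nat.add_sub_cancel]; ring
    _ ≤ 3 * k ^ 4 * E[S] * (s ^ k) ^ 2 := by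
        gcongr
        have := Nat.one_le_pow 4 k (by omega)
        omega

end Overlap

section Energy

theorem card_forall_mem_eq_le {V ι : Type*} [Fintype V] [Fintype ι] [DecidableEq V]
    [DecidableEq ι] {Q : Finset V} (hQ : Q.Nonempty) :
    #{f : V → ι | ∀ x ∈ Q, ∀ y ∈ Q, f x = f y} ≤ Fintype.card ι ^ (Fintype.card V - (#Q - 1)) := by
  obtain ⟨a, ha⟩ := hQ
  rw [← card_erase_of_mem ha, ← card_univ (α := ι)]
  refine card_le_pow_of_forall_eq_compl _ (fun _ _ _ => mem_univ _) fun f hf g hg hfg => ?_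
  simp only [mem_filter_univ] at hf hg
  ext x
  by_cases hx : x ∈ Q.erase a
  · have hxQ := mem_of_mem_erase hx
    rw [hf x hxQ a ha, hg x hxQ a ha, hfg a (notMem_erase a Q)]
  · exact hfg x hx

variable {G : Type*} [DecidableEq G]

/-- The set of entries of a quadruple. -/
def quadEntries (z : (G × G) × G × G) : Finset G := {z.1.1, z.1.2, z.2.1, z.2.2}

variable [AddCommGroup G] [Fintype G]

/-- The additive quadruples of `G`, in the ordering of their entries used in the definition of
`Finset.addEnergy`. -/
def additiveQuadruples (G : Type*) [AddCommGroup G] [Fintype G] [DecidableEq G] :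
    Finset ((G × G) × G × G) :=
  {z | z.1.1 + z.2.1 = z.1.2 + z.2.2}

theorem mem_additiveQuadruples {z : (G × G) × G × G} :
    z ∈ additiveQuadruples G ↔ z.1.1 + z.2.1 = z.1.2 + z.2.2 :=
  mem_filter_univ z

theorem card_additiveQuadruples : #(additiveQuadruples G) = Fintype.card G ^ 3 := by
  have h : E[(univ : Finset G)] = #(additiveQuadruples G) := by
    simp [addEnergy, additiveQuadruples]
  rw [← h, addEnergy_univ_left, card_univ]
  ring

theorem card_quadEntries_eq_four {z : (G × G) × G × G} (hz : z ∈ additiveQuadruples G)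
    (h₁ : z.1.1 ≠ z.1.2) (h₂ : z.1.1 ≠ z.2.2) (h₃ : z.1.1 ≠ z.2.1) (h₄ : z.1.2 ≠ z.2.2) :
    #(quadEntries z) = 4 := by
  obtain ⟨⟨a, b⟩, c, d⟩ := z
  rw [mem_additiveQuadruples] at hz
  dsimp only at hz h₁ h₂ h₃ h₄
  have hbc : b ≠ c := by
    rintro rfl
    exact h₂ (add_right_cancel (hz.trans (add_comm _ _)))
  have hcd : c ≠ d := by
    rintro rfl
    exact h₁ (add_right_cancel hz)
  rw [quadEntries, card_insert_of_notMem (by simp [h₁, h₂, h₃]),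
    card_insert_of_notMem (by simp [hbc, h₄]), card_pair hcd]

theorem card_filter_card_quadEntries_ne_four_le :
    #{z ∈ additiveQuadruples G | #(quadEntries z) ≠ 4} ≤ 4 * Fintype.card G ^ 2 := by
  have hsolve {z : (G × G) × G × G} (hz : z ∈ additiveQuadruples G) :
      z.2.1 = z.1.2 + z.2.2 - z.1.1 ∧ z.2.2 = z.1.1 + z.2.1 - z.1.2 := by
    rw [mem_additiveQuadruples] at hz
    exact ⟨eq_sub_of_add_eq' hz, eq_sub_of_add_eq' hz.symm⟩
  have hpiece (p : (G × G) × G × G → Prop) [DecidablePred p] (g : (G × G) × G × G → G × G)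
      (hg : ∀ z w, z ∈ additiveQuadruples G → w ∈ additiveQuadruples G → p z → p w →
        g z = g w → z = w) :
      #{z ∈ additiveQuadruples G | p z} ≤ Fintype.card G ^ 2 := by
    calc _ ≤ #(univ : Finset (G × G)) :=
          card_le_card_of_injOn g (fun _ _ => mem_coe.2 (mem_univ _)) fun z hz w hw =>
            hg z w (mem_filter.1 hz).1 (mem_filter.1 hw).1 (mem_filter.1 hz).2 (mem_filter.1 hw).2
      _ = Fintype.card G ^ 2 := by simp [sq]
  have hsub : {z ∈ additiveQuadruples G | #(quadEntries z) ≠ 4} ⊆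
      {z ∈ additiveQuadruples G | z.1.1 = z.1.2} ∪ {z ∈ additiveQuadruples G | z.1.1 = z.2.2} ∪
        {z ∈ additiveQuadruples G | z.1.1 = z.2.1} ∪
          {z ∈ additiveQuadruples G | z.1.2 = z.2.2} := fun z hz => by
    obtain ⟨hz, hne⟩ := mem_filter.1 hz
    simp only [mem_union, mem_filter, hz, true_and]
    by_contra! h
    exact hne (card_quadEntries_eq_four hz h.1.1.1 h.1.1.2 h.1.2 h.2)
  have h₁ := hpiece (fun z => z.1.1 = z.1.2) (fun z => (z.1.1, z.2.1)) (by grind)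
  have h₂ := hpiece (fun z => z.1.1 = z.2.2) (fun z => z.1) (by grind)
  have h₃ := hpiece (fun z => z.1.1 = z.2.1) (fun z => z.1) (by grind)
  have h₄ := hpiece (fun z => z.1.2 = z.2.2) (fun z => z.1) (by grind)
  have hle := card_le_card hsub
  grw [card_union_le, card_union_le, card_union_le] at hle
  omega

theorem sum_addEnergy_fibre {ι : Type*} [Fintype ι] [DecidableEq ι] (f : G → ι) :
    ∑ i, E[fibre f i] = #{z ∈ additiveQuadruples G |
      ∀ x ∈ quadEntries z, ∀ y ∈ quadEntries z, f x = f y} := by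
  rw [card_eq_sum_card_fiberwise (f := fun z => f z.1.1) (t := univ)
    fun _ _ => mem_coe.2 (mem_univ _)]
  refine sum_congr rfl fun i _ => congrArg card ?_
  ext ⟨⟨a, b⟩, c, d⟩
  simp only [fibre, quadEntries, mem_additiveQuadruples, mem_filter, mem_product, mem_univ,
    true_and, forall_mem_insert, mem_singleton, forall_eq]
  grind

theorem exists_pow_three_mul_sum_addEnergy_fibre_le {ι : Type*} [Fintype ι] [DecidableEq ι]
    [Nonempty ι] (hι : Fintype.card ι ^ 3 ≤ Fintype.card G) :
    ∃ f : G → ι, Fintype.card ι ^ 3 * ∑ i, E[fibre f i] ≤ 5 * Fintype.card G ^ 3 := by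
  set m := Fintype.card ι
  set N := Fintype.card G
  let mono (z : (G × G) × G × G) : ℕ :=
    #{f : G → ι | ∀ x ∈ quadEntries z, ∀ y ∈ quadEntries z, f x = f y}
  have hgen (z) (hz : #(quadEntries z) = 4) : m ^ 3 * mono z ≤ m ^ N := by
    have h4 : 4 ≤ N := hz ▸ card_le_univ _
    calc m ^ 3 * mono z ≤ m ^ 3 * m ^ (N - 3) := by
          have := card_forall_mem_eq_le (ι := ι) (Q := quadEntries z) (card_pos.1 (by omega))
          rw [hz] at this
          exact Nat.mul_le_mul_left _ this
      _ = m ^ N := by rw [← pow_add, Nat.add_sub_cancel' (by omega)]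
  have hdeg (z) : m ^ 3 * mono z ≤ N * m ^ N :=
    Nat.mul_le_mul hι ((card_le_univ _).trans (by simp [m, N]))
  have hsum : ∑ f : G → ι, m ^ 3 * ∑ i, E[fibre f i] =
      ∑ z ∈ additiveQuadruples G, m ^ 3 * mono z := by
    simp only [sum_addEnergy_fibre, mono, card_filter, ← mul_sum]
    rw [sum_comm]
  obtain ⟨f, -, hf⟩ := exists_le_of_sum_le (s := univ) (f := fun f : G → ι =>
    m ^ 3 * ∑ i, E[fibre f i]) (g := fun _ => 5 * N ^ 3) univ_nonempty <| by
      calc ∑ f : G → ι, m ^ 3 * ∑ i, E[fibre f i]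
          = ∑ z ∈ additiveQuadruples G with #(quadEntries z) = 4, m ^ 3 * mono z +
              ∑ z ∈ additiveQuadruples G with #(quadEntries z) ≠ 4, m ^ 3 * mono z := by
            rw [hsum, sum_filter_add_sum_filter_not]
        _ ≤ N ^ 3 * m ^ N + 4 * N ^ 2 * (N * m ^ N) := by
            refine add_le_add ((sum_le_card_nsmul _ _ _ fun z hz =>
              hgen z (mem_filter.1 hz).2).trans ?_) ((sum_le_card_nsmul _ _ _ fun z _ =>
              hdeg z).trans ?_)
            · exact Nat.mul_le_mul_right _
                ((card_filter_le _ _).trans card_additiveQuadruples.le)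
            · exact Nat.mul_le_mul_right _ card_filter_card_quadEntries_ne_four_le
        _ = ∑ _f : G → ι, 5 * N ^ 3 := by simp [m, N]; ring
  exact ⟨f, hf⟩

end Energy

theorem two_mul_pow_four_le_of_two_pow_mul_le_sq {k s : ℕ} (h : 2 ^ (k + 3) * k ^ 10 ≤ s ^ 2) :
    2 * k ^ 4 ≤ s := by
  rcases Nat.eq_zero_or_pos k with rfl | hk
  · simp
  refine (Nat.pow_le_pow_iff_left two_ne_zero).1 (le_trans ?_ h)
  calc (2 * k ^ 4) ^ 2 = 2 ^ 2 * k ^ 8 := by ring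
    _ ≤ 2 ^ (k + 3) * k ^ 10 := by gcongr <;> omega

section RandomColouring

variable {G : Type*} [AddCommGroup G] [DecidableEq G]

theorem isNIndepSet_cayleySumGraph_compl_image {ι : Type*} [Fintype ι] [DecidableEq ι] {x : ι → G}
    {A : Set G} (hx : Function.Injective x) (hA : (pairSums x : Set G) ⊆ A) :
    (cayleySumGraph Aᶜ).IsNIndepSet (Fintype.card ι) (univ.image x) := by
  refine ⟨isIndepSet_cayleySumGraph_compl.2 ?_, by rw [card_image_of_injective _ hx, card_univ]⟩
  simp only [coe_image, coe_univ, Set.image_univ]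
  rintro _ ⟨_, ⟨i, rfl⟩, _, ⟨j, rfl⟩, hij, rfl⟩
  exact hA <| mem_coe.2 <| mem_image.2
    ⟨s(i, j), by simpa using fun h => hij (congrArg x h), pairSum_mk x i j⟩

variable [Fintype G] {k s : ℕ}

theorem randomSubsetProb_forall_not_isNIndepSet_le {S : Finset G} (hk : 2 < k)
    (hG : Fintype.card G ≤ 2 ^ k) (hS : 2 ^ (k + 3) * k ^ 10 ≤ #S ^ 2) :
    randomSubsetProb {A : Set G | ∀ X ⊆ S, ¬ (cayleySumGraph Aᶜ).IsNIndepSet k X} ≤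
      Real.exp (-(#S ^ 4 / (24 * k ^ 4 * E[S]))) := by
  set F := genericTuples (Fin k) S
  have hsize := two_mul_pow_four_le_of_two_pow_mul_le_sq hS
  have : NeZero k := ⟨by omega⟩
  have hF : (#S : ℝ) ^ k ≤ 2 * #F := by
    exact_mod_cast Fintype.card_fin k ▸ card_pow_le_two_mul_card_genericTuples
      (ι := Fin k) (by simpa using hsize)
  have hS0 : 0 < #S := (by positivity : 0 < 2 * k ^ 4).trans_le hsize
  have hE : 0 < E[S] := addEnergy_pos (card_pos.1 hS0) (card_pos.1 hS0)
  have hcorr : ∑ x ∈ F, ∑ y ∈ F with ¬ Disjoint (pairSums y) (pairSums x),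
      (2 ^ #(pairSums y ∩ pairSums x) : ℝ) ≤ 3 * k ^ 4 * E[S] * (#S ^ k) ^ 2 / #S ^ 4 := by
    rw [le_div_iff₀' (by positivity)]
    have h := card_pow_mul_sum_two_pow_card_inter_le (ι := Fin k) (S := S) (by simpa using hk)
      (by simpa using hG) (by simpa using hS)
    rw [Fintype.card_fin] at h
    exact_mod_cast h
  calc randomSubsetProb {A : Set G | ∀ X ⊆ S, ¬ (cayleySumGraph Aᶜ).IsNIndepSet k X}
      ≤ randomSubsetProb {A : Set G | ∀ x ∈ F, ¬ (pairSums x : Set G) ⊆ A} :=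
        randomSubsetProb_mono fun A hA x hx hxA => by
          obtain ⟨hxS, hinj⟩ := mem_genericTuples.1 hx
          refine hA (univ.image x) (by simpa [Finset.image_subset_iff] using hxS) ?_
          simpa using isNIndepSet_cayleySumGraph_compl_image
            (injective_of_injOn_pairSum (by simpa using hk) hinj) hxA
    _ ≤ Real.exp (-((#F : ℝ) ^ 2 / (2 * (3 * k ^ 4 * E[S] * (#S ^ k) ^ 2 / #S ^ 4)))) :=
        janson_of_card_eq (fun x hx => card_pairSums_of_mem_genericTuples hx) hcorr
    _ ≤ Real.exp (-(#S ^ 4 / (24 * k ^ 4 * E[S]))) := by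
        refine Real.exp_le_exp.2 (neg_le_neg ?_)
        calc (#S ^ 4 / (24 * k ^ 4 * E[S]) : ℝ)
            = (#S ^ k / 2) ^ 2 / (2 * (3 * k ^ 4 * E[S] * (#S ^ k) ^ 2 / #S ^ 4)) := by
              field_simp; norm_num
          _ ≤ (#F : ℝ) ^ 2 / (2 * (3 * k ^ 4 * E[S] * (#S ^ k) ^ 2 / #S ^ 4)) := by
              gcongr; linarith

theorem card_le_of_card_mul_addEnergy_le {P : Finset G} {W : ℝ} (hW : 0 ≤ W)
    (hP : Fintype.card G * E[P] ≤ W ^ 4) : (#P : ℝ) ≤ W :=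
  le_of_pow_le_pow_left₀ four_ne_zero hW <|
    le_trans (by exact_mod_cast card_pow_four_le_card_mul_addEnergy P) hP

/- The energy bound on `P` is used twice: it passes to every `S ⊆ P`, and it forces `#P ≤ W`, so
that there are at most `exp W` sets `S` in the union bound. -/
theorem randomSubsetProb_exists_subset_forall_not_isNIndepSet_le {P : Finset G} {W : ℝ}
    (hk : 2 < k) (hG : Fintype.card G ≤ 2 ^ k) (hs : 2 ^ (k + 3) * k ^ 10 ≤ s ^ 2) (hW : 0 < W)
    (hP : Fintype.card G * E[P] ≤ W ^ 4) :
    randomSubsetProb {A : Set G | ∃ S ⊆ P, #S = s ∧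
        ∀ X ⊆ S, ¬ (cayleySumGraph Aᶜ).IsNIndepSet k X} ≤
      Real.exp W * Real.exp (-(s ^ 4 * Fintype.card G / (24 * k ^ 4 * W ^ 4))) := by
  have hone (S) (hS : S ∈ P.powersetCard s) :
      randomSubsetProb {A : Set G | ∀ X ⊆ S, ¬ (cayleySumGraph Aᶜ).IsNIndepSet k X} ≤
        Real.exp (-(s ^ 4 * Fintype.card G / (24 * k ^ 4 * W ^ 4))) := by
    obtain ⟨hSP, rfl⟩ := mem_powersetCard.1 hS
    refine (randomSubsetProb_forall_not_isNIndepSet_le hk hG hs).trans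
      (Real.exp_le_exp.2 (neg_le_neg ?_))
    have hS0 : S.Nonempty := card_pos.1 <| (by positivity : 0 < 2 * k ^ 4).trans_le
      (two_mul_pow_four_le_of_two_pow_mul_le_sq hs)
    have hE : 0 < E[S] := addEnergy_pos hS0 hS0
    have hES : (Fintype.card G * E[S] : ℝ) ≤ W ^ 4 := le_trans (by gcongr) hP
    rw [div_le_div_iff₀ (by positivity) (by positivity)]
    calc (#S ^ 4 * Fintype.card G * (24 * k ^ 4 * E[S]) : ℝ)
        = #S ^ 4 * (24 * k ^ 4) * (Fintype.card G * E[S]) := by ring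
      _ ≤ #S ^ 4 * (24 * k ^ 4) * W ^ 4 := by gcongr
      _ = #S ^ 4 * (24 * k ^ 4 * W ^ 4) := by ring
  have hcount : (#(P.powersetCard s) : ℝ) ≤ Real.exp W := by
    calc (#(P.powersetCard s) : ℝ) ≤ 2 ^ #P := by
          rw [card_powersetCard]; exact_mod_cast Nat.choose_le_two_pow _ _
      _ ≤ Real.exp 1 ^ #P := by gcongr; linarith [Real.add_one_le_exp 1]
      _ = Real.exp #P := Real.exp_one_pow _
      _ ≤ Real.exp W := Real.exp_le_exp.2 (card_le_of_card_mul_addEnergy_le hW.le hP)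
  calc _ ≤ randomSubsetProb (⋃ S ∈ P.powersetCard s,
          {A : Set G | ∀ X ⊆ S, ¬ (cayleySumGraph Aᶜ).IsNIndepSet k X}) := by
        refine randomSubsetProb_mono ?_
        rintro A ⟨S, hSP, hS, hA⟩
        exact Set.mem_biUnion (mem_powersetCard.2 ⟨hSP, hS⟩) hA
    _ ≤ #(P.powersetCard s) *
          Real.exp (-(s ^ 4 * Fintype.card G / (24 * k ^ 4 * W ^ 4))) := by
        refine (randomSubsetProb_biUnion_le _ _).trans ((sum_le_sum hone).trans_eq ?_)
        rw [sum_const, nsmul_eq_mul]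
    _ ≤ _ := by gcongr

theorem card_mul_pow_three_le_of_lt_addEnergy {P : Finset G} {W : ℝ} (hW : 0 ≤ W)
    (hP : W ^ 4 < Fintype.card G * E[P]) : #P * W ^ 3 ≤ Fintype.card G * E[P] := by
  rcases le_total (#P : ℝ) W with h | h
  · calc #P * W ^ 3 ≤ W * W ^ 3 := by gcongr
      _ = W ^ 4 := by ring
      _ ≤ _ := hP.le
  · calc #P * W ^ 3 ≤ #P * #P ^ 3 := by gcongr
      _ = (#P : ℝ) ^ 4 := by ring
      _ ≤ _ := by exact_mod_cast card_pow_four_le_card_mul_addEnergy P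

theorem sum_card_fibre_le_of_lt_addEnergy {ι : Type*} [Fintype ι] [DecidableEq ι] [Nonempty ι]
    {f : G → ι} (hf : Fintype.card ι ^ 3 * ∑ i, E[fibre f i] ≤ 5 * Fintype.card G ^ 3) {W : ℝ}
    (hW : 0 < W) {B : Finset ι} (hB : ∀ i ∈ B, W ^ 4 < Fintype.card G * E[fibre f i]) :
    (∑ i ∈ B, #(fibre f i) : ℝ) ≤ 5 * Fintype.card G ^ 4 / (Fintype.card ι ^ 3 * W ^ 3) := by
  rw [le_div_iff₀ (by positivity)]
  calc (∑ i ∈ B, #(fibre f i) : ℝ) * (Fintype.card ι ^ 3 * W ^ 3)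
      = Fintype.card ι ^ 3 * ∑ i ∈ B, #(fibre f i) * W ^ 3 := by rw [← sum_mul]; ring
    _ ≤ Fintype.card ι ^ 3 * ∑ i ∈ B, (Fintype.card G * E[fibre f i] : ℝ) := by
        refine mul_le_mul_of_nonneg_left (sum_le_sum fun i hi => ?_) (by positivity)
        exact card_mul_pow_three_le_of_lt_addEnergy hW.le (hB i hi)
    _ ≤ Fintype.card ι ^ 3 * ∑ i, (Fintype.card G * E[fibre f i] : ℝ) := by
        gcongr
        exact subset_univ B
    _ = Fintype.card G * (Fintype.card ι ^ 3 * ∑ i, E[fibre f i] : ℕ) := by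
        push_cast; rw [← mul_sum]; ring
    _ ≤ Fintype.card G * (5 * Fintype.card G ^ 3 : ℕ) := by gcongr
    _ = 5 * Fintype.card G ^ 4 := by push_cast; ring

end RandomColouring

theorem one_sub_le_randomSubsetProb_colorable {G : Type*} [AddCommGroup G] [Fintype G]
    {k s m : ℕ} {W : ℝ} (hm : 0 < m)
    (hmG : m ^ 3 ≤ Fintype.card G) (hW : 0 < W) (hk : 2 < k) (hG : Fintype.card G ≤ 2 ^ k)
    (hs : 2 ^ (k + 3) * k ^ 10 ≤ s ^ 2) :
    1 - m * (Real.exp W * Real.exp (-(s ^ 4 * Fintype.card G / (24 * k ^ 4 * W ^ 4)))) ≤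
      randomSubsetProb {A : Set G | (cayleySumGraph Aᶜ).Colorable
        ⌊(Fintype.card G / k + m * s + 5 * Fintype.card G ^ 4 / (m ^ 3 * W ^ 3) : ℝ)⌋₊} := by
  classical
  have : NeZero m := ⟨hm.ne'⟩
  obtain ⟨f, hf⟩ := exists_pow_three_mul_sum_addEnergy_fibre_le (G := G) (ι := Fin m) (by simpa)
  let I : Finset (Fin m) := {i | Fintype.card G * E[fibre f i] ≤ W ^ 4}
  let bad (i : Fin m) : Set (Set G) := {A | ∃ S ⊆ fibre f i, #S = s ∧
    ∀ X ⊆ S, ¬ (cayleySumGraph Aᶜ).IsNIndepSet k X}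
  have hbad : randomSubsetProb (⋃ i ∈ I, bad i) ≤
      m * (Real.exp W * Real.exp (-(s ^ 4 * Fintype.card G / (24 * k ^ 4 * W ^ 4)))) := by
    refine (randomSubsetProb_biUnion_le _ _).trans ((sum_le_card_nsmul _ _ _ fun i hi =>
      randomSubsetProb_exists_subset_forall_not_isNIndepSet_le hk hG hs hW
        ((mem_filter_univ i).1 hi)).trans ?_)
    rw [nsmul_eq_mul]
    gcongr
    simpa using card_le_univ I
  have hrest : (∑ i ∈ Iᶜ, #(fibre f i) : ℝ) ≤ 5 * Fintype.card G ^ 4 / (m ^ 3 * W ^ 3) := by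
    simpa using sum_card_fibre_le_of_lt_addEnergy (by simpa using hf) hW (B := Iᶜ)
      fun i hi => by simpa [I] using hi
  have hsub : (⋃ i ∈ I, bad i)ᶜ ⊆ {A : Set G | (cayleySumGraph Aᶜ).Colorable
      ⌊(Fintype.card G / k + m * s + 5 * Fintype.card G ^ 4 / (m ^ 3 * W ^ 3) : ℝ)⌋₊} := by
    intro A hA
    simp only [bad, Set.mem_compl_iff, Set.mem_iUnion, not_exists] at hA
    have hcol := colorable_of_forall_exists_isNIndepSet_fibre (s := s) (by omega : 0 < k) f I
      fun i hi S hS hSs => by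
        by_contra! h
        exact hA i hi ⟨S, hS, hSs, h⟩
    refine hcol.mono (Nat.le_floor ?_)
    push_cast
    rw [Fintype.card_fin]
    gcongr
    exact Nat.cast_div_le
  calc _ ≤ 1 - randomSubsetProb (⋃ i ∈ I, bad i) := sub_le_sub_left hbad 1
    _ = randomSubsetProb (⋃ i ∈ I, bad i)ᶜ := (randomSubsetProb_compl _).symm
    _ ≤ _ := randomSubsetProb_mono hsub

section Parameters

theorem tendsto_logb_natCast_atTop :
    Filter.Tendsto (fun N : ℕ => Real.logb 2 (N : ℝ)) Filter.atTop Filter.atTop :=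
  (Real.tendsto_logb_atTop one_lt_two).comp tendsto_natCast_atTop_atTop

theorem eventually_logb_pow_le_rpow (n : ℕ) {a : ℝ} (ha : 0 < a) :
    ∀ᶠ N : ℕ in Filter.atTop, Real.logb 2 N ^ n ≤ (N : ℝ) ^ a := by
  have hlittle := isLittleO_pow_exp_pos_mul_atTop (k := n)
    (mul_pos ha (Real.log_pos one_lt_two))
  filter_upwards [tendsto_logb_natCast_atTop.eventually (hlittle.bound one_pos),
    Filter.eventually_gt_atTop 0] with N hN hN0
  rw [one_mul, Real.norm_of_nonneg (Real.exp_pos _).le] at hN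
  refine (le_abs_self _).trans (hN.trans_eq ?_)
  rw [Real.rpow_def_of_pos (by exact_mod_cast hN0), Real.logb]
  congr 1
  field_simp

theorem two_pow_mul_pow_le_sq {η l N : ℝ} {k s : ℕ} (hl : 2 ^ 17 ≤ l) (hN : 0 < N)
    (hlN : l ^ 51 ≤ N ^ η) (hk : (2 : ℝ) ^ k ≤ N ^ (2 - η)) (hkl : k ≤ 2 * l)
    (hs : N / (4 * l ^ 20) ≤ s) : 2 ^ (k + 3) * k ^ 10 ≤ s ^ 2 := by
  have : 0 < l := by linarith
  have h : (2 ^ (k + 3) * k ^ 10 : ℝ) ≤ s ^ 2 := by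
    calc (2 ^ (k + 3) * k ^ 10 : ℝ) = 8 * 2 ^ k * k ^ 10 := by ring
      _ ≤ 8 * N ^ (2 - η) * (2 * l) ^ 10 := by gcongr
      _ = 2 ^ 17 * l ^ 50 * N ^ (2 - η) / (16 * l ^ 40) := by field_simp; norm_num
      _ ≤ l * l ^ 50 * N ^ (2 - η) / (16 * l ^ 40) := by gcongr
      _ = l ^ 51 * N ^ (2 - η) / (16 * l ^ 40) := by ring
      _ ≤ N ^ η * N ^ (2 - η) / (16 * l ^ 40) := by gcongr
      _ = N ^ 2 / (16 * l ^ 40) := by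
          rw [← Real.rpow_add hN, add_sub_cancel, Real.rpow_two]
      _ = (N / (4 * l ^ 20)) ^ 2 := by ring
      _ ≤ s ^ 2 := by gcongr
  exact_mod_cast h

theorem mul_exp_mul_exp_le {l N m s k δ : ℝ} (hl : 12288 ≤ l) (hδ : 24576 ≤ δ * l)
    (hN : l ^ 35 ≤ N) (hm : l ^ 18 ≤ m) (hm' : m ≤ 2 * l ^ 18) (hs : N / (m * l ^ 2) / 2 ≤ s)
    (hk0 : 0 < k) (hk : k ≤ 2 * l) :
    m * (Real.exp (l * N / m) *
      Real.exp (-(s ^ 4 * N / (24 * k ^ 4 * (l * N / m) ^ 4)))) ≤ δ := by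
  have : 0 < l := by linarith
  have hN0 : 0 < N := lt_of_lt_of_le (by positivity) hN
  have hm0 : 0 < m := lt_of_lt_of_le (by positivity) hm
  set x := N / (12288 * l ^ 16) with hx
  have : 0 < x := by positivity
  have hWx : l * N / m ≤ x := by
    rw [hx, div_le_div_iff₀ hm0 (by positivity)]
    calc l * N * (12288 * l ^ 16) ≤ l * N * (l * l ^ 16) := by gcongr
      _ = N * l ^ 18 := by ring
      _ ≤ N * m := by gcongr
  have hsx : 2 * x ≤ s ^ 4 * N / (24 * k ^ 4 * (l * N / m) ^ 4) := by
    calc 2 * x = (N / (m * l ^ 2) / 2) ^ 4 * N / (24 * (2 * l) ^ 4 * (l * N / m) ^ 4) := by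
          rw [hx]; field_simp; norm_num
      _ ≤ _ := by gcongr
  have hexp : Real.exp (l * N / m) *
      Real.exp (-(s ^ 4 * N / (24 * k ^ 4 * (l * N / m) ^ 4))) ≤ x⁻¹ := by
    rw [← Real.exp_add]
    calc _ ≤ Real.exp (-x) := Real.exp_le_exp.2 (by linarith)
      _ = (Real.exp x)⁻¹ := Real.exp_neg x
      _ ≤ x⁻¹ := by
          gcongr
          linarith [Real.add_one_le_exp x]
  calc _ ≤ (2 * l ^ 18) * x⁻¹ := by gcongr
    _ = 24576 * l ^ 34 / N := by rw [hx]; field_simp; norm_num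
    _ ≤ δ * l * l ^ 34 / N := by gcongr
    _ = δ * (l ^ 35 / N) := by ring
    _ ≤ δ := mul_le_of_le_one_right (by nlinarith) ((div_le_one hN0).2 hN)

theorem div_add_div_sq_add_div_cube_le {ε η l N k : ℝ} (hη : 0 < η) (hη4 : η ≤ 1 / 4)
    (hηε : η ≤ ε / 4) (hl : 1 ≤ l) (hlε : 24 ≤ ε * l) (hlη : 1 ≤ η * l) (hN : 0 ≤ N)
    (hk : (2 - η) * l - 1 ≤ k) :
    N / k + N / l ^ 2 + 5 * N / l ^ 3 ≤ (1 + ε) * (N / (2 * l)) := by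
  have hl0 : 0 < l := by linarith
  have hk' : (2 - 2 * η) * l ≤ k := by linarith
  have hp : 0 < 2 - 2 * η := by linarith
  have hmain : N / k ≤ (1 / 2 + η) * (N / l) := by
    calc N / k ≤ N / ((2 - 2 * η) * l) := by gcongr
      _ = (1 / (2 - 2 * η)) * (N / l) := by field_simp
      _ ≤ (1 / 2 + η) * (N / l) := by
          gcongr
          rw [div_le_iff₀ hp]
          nlinarith
  have hcube : 5 * N / l ^ 3 ≤ 5 * N / l ^ 2 := by
    gcongr
    norm_num
  calc N / k + N / l ^ 2 + 5 * N / l ^ 3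
      ≤ (1 / 2 + η) * (N / l) + N / l ^ 2 + 5 * N / l ^ 2 := by gcongr
    _ = (1 / 2 + η + 6 / l) * (N / l) := by field_simp; ring
    _ ≤ (1 / 2 + ε / 4 + ε / 4) * (N / l) := by
        have : 6 / l ≤ ε / 4 := by rw [div_le_iff₀ hl0]; linarith
        gcongr
    _ = (1 + ε) * (N / (2 * l)) := by field_simp; ring

theorem exists_indepSet_size {η : ℝ} {N : ℕ} (hN : 0 < N) (hη : 0 < η) (hη4 : η ≤ 1 / 4)
    (hl : 4 ≤ Real.logb 2 N) :
    ∃ k : ℕ, 2 < k ∧ N ≤ 2 ^ k ∧ (2 : ℝ) ^ k ≤ (N : ℝ) ^ (2 - η) ∧ k ≤ 2 * Real.logb 2 N ∧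
      (2 - η) * Real.logb 2 N - 1 ≤ k := by
  set l := Real.logb 2 N
  have hNl : (2 : ℝ) ^ l = N := Real.rpow_logb two_pos (by norm_num) (by exact_mod_cast hN)
  have hk_le : (⌊(2 - η) * l⌋₊ : ℝ) ≤ (2 - η) * l :=
    Nat.floor_le (mul_nonneg (by linarith) (by linarith))
  have hle_k : (2 - η) * l - 1 ≤ ⌊(2 - η) * l⌋₊ := (Nat.sub_one_lt_floor _).le
  have hlk : l ≤ ⌊(2 - η) * l⌋₊ := by nlinarith
  refine ⟨⌊(2 - η) * l⌋₊, ?_, ?_, ?_, by nlinarith, hle_k⟩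
  · have : (2 : ℝ) < ⌊(2 - η) * l⌋₊ := by linarith
    exact_mod_cast this
  · have : (N : ℝ) ≤ 2 ^ ⌊(2 - η) * l⌋₊ := by
      rw [← hNl, ← Real.rpow_natCast]
      exact Real.rpow_le_rpow_of_exponent_le one_le_two hlk
    exact_mod_cast this
  · rw [← hNl, ← Real.rpow_mul two_pos.le, ← Real.rpow_natCast, mul_comm l]
    exact Real.rpow_le_rpow_of_exponent_le one_le_two hk_le

theorem exists_part_sizes {l N : ℝ} (hl : 8 ≤ l) (hN : l ^ 55 ≤ N) :
    ∃ m s : ℕ, l ^ 18 ≤ m ∧ m ≤ 2 * l ^ 18 ∧ m ^ 3 ≤ N ∧ m * s ≤ N / l ^ 2 ∧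
      N / (m * l ^ 2) / 2 ≤ s := by
  have : 0 < l := by linarith
  have hN0 : 0 < N := lt_of_lt_of_le (by positivity) hN
  have hm : l ^ 18 ≤ ⌈l ^ 18⌉₊ := Nat.le_ceil _
  have hm' : (⌈l ^ 18⌉₊ : ℝ) ≤ 2 * l ^ 18 :=
    Nat.ceil_le_two_mul ((by norm_num : (2⁻¹ : ℝ) ≤ 1).trans (one_le_pow₀ (by linarith)))
  set m := ⌈l ^ 18⌉₊
  have hm0 : (0 : ℝ) < m := lt_of_lt_of_le (by positivity) hm
  refine ⟨m, ⌊N / (m * l ^ 2)⌋₊, hm, hm', ?_, ?_, ?_⟩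
  · calc (m ^ 3 : ℝ) ≤ (2 * l ^ 18) ^ 3 := by gcongr
      _ = 8 * l ^ 54 := by ring
      _ ≤ l * l ^ 54 := by gcongr
      _ = l ^ 55 := by ring
      _ ≤ N := hN
  · calc (m * ⌊N / (m * l ^ 2)⌋₊ : ℝ) ≤ m * (N / (m * l ^ 2)) := by
          gcongr; exact Nat.floor_le (by positivity)
      _ = N / l ^ 2 := by field_simp
  · refine (Nat.div_two_lt_floor ((one_le_div₀ (by positivity)).2 ?_)).le
    calc m * l ^ 2 ≤ 2 * l ^ 18 * l ^ 2 := by gcongr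
      _ ≤ l * l ^ 18 * l ^ 2 := by gcongr; linarith
      _ = l ^ 21 := by ring
      _ ≤ l ^ 55 := pow_le_pow_right₀ (by linarith) (by norm_num)
      _ ≤ N := hN

/- With `l = log₂ N`, take `m ≈ l ^ 18`, `s ≈ N / l ^ 20` and `W ≈ N / l ^ 17`: then the gain
`s ^ 4 * N / (k ^ 4 * W ^ 4) ≈ N / l ^ 16` in the exponent beats the loss `W`. -/
theorem exists_colouring_parameters {ε δ η : ℝ} {N : ℕ} (hη : 0 < η) (hη4 : η ≤ 1 / 4)
    (hηε : η ≤ ε / 4) (hl : 2 ^ 17 ≤ Real.logb 2 N) (hlδ : 24576 ≤ δ * Real.logb 2 N)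
    (hlε : 24 ≤ ε * Real.logb 2 N) (hlη : 1 ≤ η * Real.logb 2 N)
    (hN : Real.logb 2 N ^ 55 ≤ N) (hNη : Real.logb 2 N ^ 51 ≤ (N : ℝ) ^ η) :
    ∃ (k s m : ℕ) (W : ℝ), 0 < m ∧ m ^ 3 ≤ N ∧ 0 < W ∧ 2 < k ∧ N ≤ 2 ^ k ∧
      2 ^ (k + 3) * k ^ 10 ≤ s ^ 2 ∧
      (N / k + m * s + 5 * N ^ 4 / (m ^ 3 * W ^ 3) : ℝ) ≤ (1 + ε) * (N / (2 * Real.logb 2 N)) ∧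
      m * (Real.exp W * Real.exp (-(s ^ 4 * N / (24 * k ^ 4 * W ^ 4)))) ≤ δ := by
  have hl0 : 0 < Real.logb 2 N := by linarith
  have hN0 : 0 < (N : ℝ) := lt_of_lt_of_le (by positivity) hN
  obtain ⟨k, hk2, hNk, hkN, hkl, hlk⟩ :=
    exists_indepSet_size (by exact_mod_cast hN0) hη hη4 (by linarith)
  obtain ⟨m, s, hm, hm', hmN, hms, hs⟩ := exists_part_sizes (by linarith) hN
  set l := Real.logb 2 N
  have hm0 : (0 : ℝ) < m := lt_of_lt_of_le (by positivity) hm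
  have hs' : (N : ℝ) / (4 * l ^ 20) ≤ s := by
    calc (N : ℝ) / (4 * l ^ 20) = N / (2 * l ^ 18 * l ^ 2) / 2 := by field_simp; norm_num
      _ ≤ N / (m * l ^ 2) / 2 := by gcongr
      _ ≤ s := hs
  refine ⟨k, s, m, l * N / m, by exact_mod_cast hm0, by exact_mod_cast hmN, by positivity, hk2, hNk,
    two_pow_mul_pow_le_sq hl hN0 hNη hkN hkl hs', ?_, ?_⟩
  · calc (N / k + m * s + 5 * N ^ 4 / (m ^ 3 * (l * N / m) ^ 3) : ℝ)
        = N / k + m * s + 5 * N / l ^ 3 := by congr 1; field_simp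
      _ ≤ N / k + N / l ^ 2 + 5 * N / l ^ 3 := by gcongr
      _ ≤ (1 + ε) * (N / (2 * l)) :=
          div_add_div_sq_add_div_cube_le hη hη4 hηε (by linarith) hlε hlη hN0.le hlk
  · exact mul_exp_mul_exp_le (by linarith) hlδ
      ((pow_le_pow_right₀ (by linarith) (by norm_num)).trans hN) hm hm' hs (by positivity) hkl

theorem eventually_exists_colouring_parameters {ε δ : ℝ} (hε : 0 < ε) (hδ : 0 < δ) :
    ∀ᶠ N : ℕ in Filter.atTop, ∃ (k s m : ℕ) (W : ℝ), 0 < m ∧ m ^ 3 ≤ N ∧ 0 < W ∧ 2 < k ∧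
      N ≤ 2 ^ k ∧ 2 ^ (k + 3) * k ^ 10 ≤ s ^ 2 ∧
      (N / k + m * s + 5 * N ^ 4 / (m ^ 3 * W ^ 3) : ℝ) ≤ (1 + ε) * (N / (2 * Real.logb 2 N)) ∧
      m * (Real.exp W * Real.exp (-(s ^ 4 * N / (24 * k ^ 4 * W ^ 4)))) ≤ δ := by
  set η := min (1 / 4) (ε / 4)
  have hη : 0 < η := by positivity
  have hlarge (C : ℝ) : ∀ᶠ N : ℕ in Filter.atTop, C ≤ Real.logb 2 N :=
    tendsto_logb_natCast_atTop.eventually_ge_atTop C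
  filter_upwards [hlarge (2 ^ 17), hlarge (24576 / δ), hlarge (24 / ε), hlarge (1 / η),
    eventually_logb_pow_le_rpow 55 one_pos, eventually_logb_pow_le_rpow 51 hη]
    with N hl hlδ hlε hlη hN hNη
  exact exists_colouring_parameters hη (min_le_left _ _) (min_le_right _ _) hl
    ((div_le_iff₀' hδ).1 hlδ) ((div_le_iff₀' hε).1 hlε) ((div_le_iff₀' hη).1 hlη)
    (by simpa using hN) hNη

theorem eventually_mul_div_logb_le_self (C : ℝ) :
    ∀ᶠ N : ℕ in Filter.atTop, C * (N / (2 * Real.logb 2 N)) ≤ N := by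
  filter_upwards [tendsto_logb_natCast_atTop.eventually_gt_atTop 0,
    tendsto_logb_natCast_atTop.eventually_ge_atTop C] with N hl hC
  rw [mul_div_assoc', div_le_iff₀ (by positivity)]
  nlinarith [N.cast_nonneg (α := ℝ)]

end Parameters

theorem exists_forall_one_sub_le_randomSubsetProb_colorable {ε δ : ℝ} (hε : 0 < ε) (hδ : 0 < δ) :
    ∃ N₀ : ℕ, ∀ (G : Type*) [AddCommGroup G] [Fintype G], N₀ ≤ Fintype.card G →
      (1 + ε) * ((Fintype.card G : ℝ) / (2 * Real.logb 2 (Fintype.card G))) ≤ Fintype.card G ∧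
      1 - δ ≤ randomSubsetProb {A : Set G | (cayleySumGraph Aᶜ).Colorable
        ⌊(1 + ε) * ((Fintype.card G : ℝ) / (2 * Real.logb 2 (Fintype.card G)))⌋₊} := by
  obtain ⟨N₀, hN₀⟩ := Filter.eventually_atTop.1
    ((eventually_mul_div_logb_le_self (1 + ε)).and (eventually_exists_colouring_parameters hε hδ))
  refine ⟨N₀, fun G _ _ hG => ?_⟩
  obtain ⟨hle, k, s, m, W, hm, hmG, hW, hk, hGk, hs, hcolours, hfail⟩ := hN₀ _ hG
  exact ⟨hle, (sub_le_sub_left hfail 1).trans <|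
    (one_sub_le_randomSubsetProb_colorable hm hmG hW hk hGk hs).trans <|
      randomSubsetProb_mono fun A hA => hA.mono (Nat.floor_mono hcolours)⟩

theorem theorem1p1_general (ε : ℝ) (hε : 0 < ε) (δ : ℝ) (hδ : 0 < δ) :
    ∃ N₀ : ℕ, ∀ (G : Type*) [AddCommGroup G] [Fintype G], N₀ ≤ Fintype.card G →
        1 - δ ≤ randomSubsetProb {A : Set G | ∃ k : ℕ,
            (cayleySumGraph A).chromaticNumber = (k : ℕ∞) ∧
            (k : ℝ) ≤ (1 + ε) * ((Fintype.card G : ℝ) / (2 * Real.logb 2 (Fintype.card G)))} ∧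
        1 - δ ≤ randomSubsetProb {A : Set G |
            ∃ X : Fin ⌊(1 + ε) * ((Fintype.card G : ℝ) /
                (2 * Real.logb 2 (Fintype.card G)))⌋₊ → Set G,
              IsPartitionInto _ X ∧ ∀ i, restrictedSumset (X i) ⊆ A} := by
  obtain ⟨N₀, hN₀⟩ := exists_forall_one_sub_le_randomSubsetProb_colorable hε hδ
  refine ⟨N₀, fun G _ _ hG => ?_⟩
  obtain ⟨hle, hcol⟩ := hN₀ G hG
  constructor
  · have hlog : 0 ≤ Real.logb 2 (Fintype.card G) :=
      Real.logb_nonneg one_lt_two (mod_cast Fintype.card_pos)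
    rw [← randomSubsetProb_preimage_compl] at hcol
    refine hcol.trans (randomSubsetProb_mono fun A hA => ?_)
    rw [Set.mem_preimage, Set.mem_ofPred_eq, compl_compl] at hA
    obtain ⟨k, hk, hkn⟩ := exists_chromaticNumber_eq_of_colorable hA
    exact ⟨k, hk, (Nat.cast_le.2 hkn).trans (Nat.floor_le (by positivity))⟩
  · exact hcol.trans (randomSubsetProb_mono fun A hA =>
      exists_isPartitionInto_of_colorable hA le_rfl (Nat.floor_le_of_le hle))

theorem theorem1p1 (ε : ℝ) (hε : 0 < ε) (δ : ℝ) (hδ : 0 < δ) :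
    ∃ N₀ : ℕ, ∀ (G : Type*) [AddCommGroup G] [Fintype G],
      N₀ ≤ Fintype.card G → Nat.Coprime (Fintype.card G) 6 →
        1 - δ ≤ randomSubsetProb {A : Set G | ∃ k : ℕ,
            (cayleySumGraph A).chromaticNumber = (k : ℕ∞) ∧
            (k : ℝ) ≤ (1 + ε) * ((Fintype.card G : ℝ) / (2 * Real.logb 2 (Fintype.card G)))} ∧
        1 - δ ≤ randomSubsetProb {A : Set G |
            ∃ X : Fin ⌊(1 + ε) * ((Fintype.card G : ℝ) /
                (2 * Real.logb 2 (Fintype.card G)))⌋₊ → Set G,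
              IsPartitionInto _ X ∧ ∀ i, restrictedSumset (X i) ⊆ A} := by
  obtain ⟨N₀, hN₀⟩ := theorem1p1_general ε hε δ hδ
  exact ⟨N₀, fun G _ _ hG _ => hN₀ G hG⟩
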